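/- Let $(a_j)_{j\ge1}$ be a sequence of non-negative integers. Consider combinatorial objects (multisets) built from unordered components, where there are exactly $a_j$ types of components of size $j$; the size of an object is the sum of the sizes of its components. Let $c_n$ be the number of multisets of size $n$ (component types may be repeated), and let $\tilde c_n$ be the number of selections of size $n$, i.e. multisets in which no component type appears more than once. Equivalently, $\sum_n c_nx^n=\prod_{j\ge1}(1-x^j)^{-a_j}$ and $\sum_n\tilde c_nx^n=\prod_{j\ge1}(1+x^j)^{a_j}$. Below, $u_n\sim v_n$ means $u_n/v_n\to1$ as $n\to\infty$. (1) Suppose that, for some $r>0$ and $y\ge1$, there are constants $D_1,D_2>0$ with $D_1\,j^{r-1}y^j\le a_j\le D_2\,j^{r-1}y^j$ for all $j\ge1$. Then for all sufficiently large $n$ the equation $$\tilde M_n:=\sum_{j=1}^n\frac{j a_j e^{-j\sigma}}{1+e^{-j\sigma}}=n$$ has exactly one real solution $\sigma=\tilde\sigma_n$, and $\tilde\sigma_n>0$. With $\tilde B_n^2:=\sum_{j=1}^n \dfrac{j^2a_je^{-j\tilde\sigma_n}}{(1+e^{-j\tilde\sigma_n})^2}$ one has $$\tilde c_n\sim\frac{e^{n\tilde\sigma_n}}{\sqrt{2\pi\tilde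 B_n^2}}\prod_{j=1}^n\left(1+e^{-j\tilde\sigma_n}\right)^{a_j}.$$ (2) Suppose that $a_j=Kj^{r-1}y^j+O(y^{\nu j})$ as $j\to\infty$, where $K>0$, $r>0$, $y>1$ and $\nu\in(0,1)$. Put $\kappa_2=\frac{r+1}{r}\,(K\,\Gamma(r+1))^{1/(r+1)}$. Then there are positive constants $\kappa_1\ne\tilde\kappa_1$ (depending on the sequence $(a_j)$) such that $$c_n\sim\kappa_1\,y^n\,n^{-\frac{r+2}{2(r+1)}}\exp\!\left(\kappa_2\,n^{r/(r+1)}\right),\qquad \tilde c_n\sim\tilde\kappa_1\,y^n\,n^{-\frac{r+2}{2(r+1)}}\exp\!\left(\kappa_2\,n^{r/(r+1)}\right).$$ -/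

import Mathlib

open Filter Asymptotics

noncomputable section

/-- The component types determined by the parameters `a j`, `j ≥ 1`: exactly `a j` types of
size `j`. (The value `a 0` plays no role.) -/
abbrev ComponentType (a : ℕ → ℕ) : Type := Σ j : ℕ+, Fin (a j)

/-- The total size of a multiset of components. -/
def totalSize {a : ℕ → ℕ} (m : Multiset (ComponentType a)) : ℕ :=
  (m.map fun t => (t.1 : ℕ)).sum

/-- The multisets of components of total size `n`. -/
def multisetsOfSize (a : ℕ → ℕ) (n : ℕ) : Set (Multiset (ComponentType a)) :=
  {m | totalSize m = n}

/-- The selections of total size `n`: the multisets of total size `n` in which no component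
type appears more than once. -/
def selectionsOfSize (a : ℕ → ℕ) (n : ℕ) : Set (Multiset (ComponentType a)) :=
  {m | m ∈ multisetsOfSize a n ∧ m.Nodup}

/-- The sets counted below are finite, so that `Set.ncard` is the true number of elements. -/
theorem multisetsOfSize_finite (a : ℕ → ℕ) (n : ℕ) : (multisetsOfSize a n).Finite := by
  classical
  have hT : {t : ComponentType a | (t.1 : ℕ) ≤ n}.Finite := by
    have h1 : {j : ℕ+ | (j : ℕ) ≤ n}.Finite :=
      (Set.finite_Iic n).preimage (PNat.coe_injective.injOn)
    have h2 : {t : ComponentType a | (t.1 : ℕ) ≤ n} =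
        ⋃ j ∈ {j : ℕ+ | (j : ℕ) ≤ n}, Set.range (fun i : Fin (a j) => (⟨j, i⟩ : ComponentType a)) := by
      ext ⟨j, i⟩
      simp only [Set.mem_ofPred_eq, Set.mem_iUnion, Set.mem_range, exists_prop]
      constructor
      · intro h
        exact ⟨j, h, i, rfl⟩
      · rintro ⟨k, hk, l, hl⟩
        cases hl
        exact hk
    rw [h2]
    exact h1.biUnion fun j _ => Set.finite_range _
  refine (Multiset.powerset (n • hT.toFinset.val)).toFinset.finite_toSet.subset ?_
  intro m hm
  have hm' : (m.map fun t => (t.1 : ℕ)).sum = n := hm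
  simp only [Finset.mem_coe, Multiset.mem_toFinset, Multiset.mem_powerset]
  rw [Multiset.le_iff_count]
  intro t
  by_cases ht : t ∈ m
  · have hsz : (t.1 : ℕ) ≤ n := hm' ▸ Multiset.single_le_sum (fun _ _ => Nat.zero_le _) _
      (Multiset.mem_map_of_mem (fun t : ComponentType a => (t.1 : ℕ)) ht)
    have hc : m.card ≤ n := by
      rw [← hm']
      have := Multiset.card_nsmul_le_sum (s := m.map fun t => (t.1 : ℕ)) (a := 1)
        (fun x hx => by
          obtain ⟨t, -, rfl⟩ := Multiset.mem_map.1 hx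
          exact t.1.pos)
      simpa using this
    rw [Multiset.count_nsmul, Multiset.count_eq_one_of_mem hT.toFinset.nodup
      (by simpa using hsz), mul_one]
    exact (Multiset.count_le_card _ _).trans hc
  · rw [Multiset.count_eq_zero_of_notMem ht]
    exact Nat.zero_le _

/-- `c_n`: the number of multisets of size `n`. -/
def multisetCount (a : ℕ → ℕ) (n : ℕ) : ℕ := (multisetsOfSize a n).ncard

/-- `c̃_n`: the number of selections of size `n`. -/
def selectionCount (a : ℕ → ℕ) (n : ℕ) : ℕ := (selectionsOfSize a n).ncard

/-- `M̃_n` as a function of the parameter `σ`. -/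
def selectionMean (a : ℕ → ℕ) (n : ℕ) (σ : ℝ) : ℝ :=
  ∑ j ∈ Finset.Icc 1 n, (j : ℝ) * (a j : ℝ) * Real.exp (-(j * σ)) / (1 + Real.exp (-(j * σ)))

/-- `B̃_n²` as a function of the parameter `σ`. -/
def selectionVariance (a : ℕ → ℕ) (n : ℕ) (σ : ℝ) : ℝ :=
  ∑ j ∈ Finset.Icc 1 n,
    (j : ℝ) ^ 2 * (a j : ℝ) * Real.exp (-(j * σ)) / (1 + Real.exp (-(j * σ))) ^ 2

/-- `a_j ≍ j^{r-1} y^j`: two-sided bounds with positive constants, for all `j ≥ 1`. -/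
def Expansive (a : ℕ → ℕ) (r y : ℝ) : Prop :=
  ∃ D₁ D₂ : ℝ, 0 < D₁ ∧ 0 < D₂ ∧ ∀ j : ℕ, 1 ≤ j →
    D₁ * ((j : ℝ) ^ (r - 1) * y ^ j) ≤ (a j : ℝ) ∧
      (a j : ℝ) ≤ D₂ * ((j : ℝ) ^ (r - 1) * y ^ j)

/-- `y^n n^{-(r+2)/(2(r+1))} exp(κ₂ n^{r/(r+1)})` with `κ₂ = ((r+1)/r) (K Γ(r+1))^{1/(r+1)}`. -/
def explicitGrowth (K r y : ℝ) (n : ℕ) : ℝ :=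
  y ^ n * (n : ℝ) ^ (-((r + 2) / (2 * (r + 1)))) *
    Real.exp ((r + 1) / r * (K * Real.Gamma (r + 1)) ^ (1 / (r + 1)) * (n : ℝ) ^ (r / (r + 1)))

end

/-! Both counts are coefficients of generating functions. Components larger than n cannot occur, so
the factors with j ≤ n suffice, and Cauchy's formula on the circle |x| = e^{-σ} gives an integral
over θ ∈ [-π, π], evaluated by the saddle point method. With δ = σ - log y, the sums involved are
comparable to ∑ j^s e^{-jδ}, of order δ^{-(s+1)} for s > 0 as δ → 0.

Selections with a_j ≍ j^{r-1} y^j: divided by its value at θ = 0, the integrand is the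
characteristic function, centred at n, of a sum of independent variables, one for each component
type, equal to j times a Bernoulli variable of odds e^{-jσ}. The equation for σ says that the mean
is n. The variance B² has order δ^{-(r+2)} and the third-moment sum is O(δ^{-(r+3)}), so at θ = t/B
the distance to e^{-t²/2} is O(δ^{r/2}) (`norm_selectionChar_sub_le`). For all |θ| ≤ π, the cosine
estimate `exists_le_sum_powExp_mul_one_sub_cos` bounds the modulus by exp(-c min((Bθ)², δ^{-r})),
and B e^{-cδ^{-r}} → 0. Then `tendsto_mul_integral_of_gaussian_limit` shows that B times the
integral tends to √(2π).

Explicit asymptotics: put x = z/y. Since y > 1, the logarithm of the j-th factor is K j^{r-1} z^j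
plus a remainder summable uniformly on |z| ≤ 1, for multisets and selections alike. Both generating
functions thus share the singular part exp(K ∑ j^{r-1} z^j), and the remainders only contribute e^H,
with H their sum at z = 1. Poisson summation gives ∑ j^r e^{-jδ} = Γ(r+1) δ^{-(r+1)} + O(1), so the
explicit δ with K Γ(r+1) δ^{-(r+1)} = n misses the saddle point equation by O(1) only, which is
harmless at θ = t/B → 0. Everything is then computable, and the two constants differ because the two
values of H differ by -∑ a_j log(1 - y^{-2j}) > 0. -/

/-! ### Counting multisets by coefficients of finite products -/

/-- The power series `∑_{k ∈ A} X^{jk}`. -/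
noncomputable def multiplicitySeries (A : Set ℕ) (j : ℕ) : PowerSeries ℂ :=
  open Classical in PowerSeries.mk fun m => if ∃ k ∈ A, m = j * k then 1 else 0

theorem totalSize_eq_sum_count {a : ℕ → ℕ} (m : Multiset (ComponentType a)) :
    totalSize m = ∑ t ∈ m.toFinset, (t.1 : ℕ) * m.count t := by
  unfold totalSize
  rw [Finset.sum_multiset_map_count]
  exact Finset.sum_congr rfl fun t _ => by rw [smul_eq_mul, mul_comm]

theorem size_le_totalSize {a : ℕ → ℕ} {m : Multiset (ComponentType a)} {t : ComponentType a}
    (ht : t ∈ m) : (t.1 : ℕ) ≤ totalSize m :=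
  Multiset.single_le_sum (fun _ _ => Nat.zero_le _) _
    (Multiset.mem_map_of_mem (fun t : ComponentType a => (t.1 : ℕ)) ht)

/-- A multiset of size n is determined by the amount (size times multiplicity) that each type
contributes to n, and the coefficient of a product counts exactly such distributions. The set `A` of
allowed multiplicities treats both models at once: all of ℕ for multisets, {0, 1} for selections. -/
theorem ncard_multisets_eq_coeff_prod (a : ℕ → ℕ) {n : ℕ} (A : Set ℕ) (hA : 0 ∈ A)
    (T : Finset (ComponentType a)) (hT : ∀ t : ComponentType a, t ∈ T ↔ (t.1 : ℕ) ≤ n) :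
    (({m | m ∈ multisetsOfSize a n ∧ ∀ t, m.count t ∈ A}.ncard : ℕ) : ℂ) =
      PowerSeries.coeff n (∏ t ∈ T, multiplicitySeries A t.1) := by
  classical
  rw [PowerSeries.coeff_prod]
  simp only [multiplicitySeries, PowerSeries.coeff_mk]
  simp_rw [Finset.prod_boole]
  rw [Finset.sum_boole, ← Set.ncard_coe_finset]
  congr 1
  refine Set.ncard_congr
    (fun m _ => Finsupp.onFinset m.toFinset (fun t => (t.1 : ℕ) * m.count t) ?_) ?_ ?_ ?_
  · intro t ht
    by_contra hc
    rw [Multiset.mem_toFinset] at hc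
    exact ht (by rw [Multiset.count_eq_zero_of_notMem hc, mul_zero])
  · rintro m ⟨hm, hmA⟩
    have hm' : totalSize m = n := hm
    have hsub : m.toFinset ⊆ T := fun t ht =>
      (hT t).2 (hm' ▸ size_le_totalSize (Multiset.mem_toFinset.1 ht))
    simp only [Finset.coe_filter, Finset.mem_finsuppAntidiag, Set.mem_ofPred_eq,
      Finsupp.onFinset_apply]
    refine ⟨⟨?_, (Finsupp.support_onFinset_subset).trans hsub⟩, fun t _ => ⟨_, hmA t, rfl⟩⟩
    rw [← hm', totalSize_eq_sum_count]
    refine (Finset.sum_subset hsub fun t _ ht => ?_).symm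
    rw [Finsupp.onFinset_apply, Multiset.count_eq_zero_of_notMem (by simpa using ht), mul_zero]
  · intro m m' _ _ h
    ext t
    have := DFunLike.congr_fun h t
    simp only [Finsupp.onFinset_apply] at this
    exact Nat.eq_of_mul_eq_mul_left t.1.pos this
  · intro l hl
    simp only [Finset.coe_filter, Finset.mem_finsuppAntidiag, Set.mem_ofPred_eq] at hl
    obtain ⟨⟨hsum, hsupp⟩, hex⟩ := hl
    have hdiv : ∀ t, ∃ k ∈ A, l t = t.1 * k := by
      intro t
      by_cases ht : t ∈ T
      · exact hex t ht
      · exact ⟨0, hA, by rw [mul_zero]; exact Finsupp.notMem_support_iff.1 fun h => ht (hsupp h)⟩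
    choose k hkA hk using hdiv
    let m : Multiset (ComponentType a) := ∑ t ∈ T, k t • {t}
    have hcount : ∀ t, m.count t = k t := by
      intro t
      simp only [m, Multiset.count_sum', Multiset.count_nsmul, Multiset.count_singleton]
      simp only [mul_ite, mul_one, mul_zero, Finset.sum_ite_eq]
      split_ifs with ht
      · rfl
      · have h0 : l t = 0 := Finsupp.notMem_support_iff.1 fun h => ht (hsupp h)
        rw [hk t] at h0
        exact ((Nat.mul_eq_zero.1 h0).resolve_left t.1.pos.ne').symm
    refine ⟨m, ⟨?_, fun t => by rw [hcount]; exact hkA t⟩, ?_⟩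
    · have hsub : m.toFinset ⊆ T := by
        intro t ht
        by_contra hc
        have h0 : l t = 0 := Finsupp.notMem_support_iff.1 fun h => hc (hsupp h)
        rw [hk t] at h0
        have := (Nat.mul_eq_zero.1 h0).resolve_left t.1.pos.ne'
        rw [← hcount] at this
        exact Multiset.count_ne_zero.2 (Multiset.mem_toFinset.1 ht) this
      change totalSize m = n
      rw [totalSize_eq_sum_count, ← hsum]
      rw [Finset.sum_subset hsub fun t _ ht => by
        rw [Multiset.count_eq_zero_of_notMem (by simpa using ht), mul_zero]]
      exact Finset.sum_congr rfl fun t _ => by rw [hcount, hk]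
    · ext t
      simp only [Finsupp.onFinset_apply]
      rw [hcount, hk]

theorem ncard_multisets_eq_coeff (a : ℕ → ℕ) {n : ℕ} (hn : 1 ≤ n) (A : Set ℕ) (hA : 0 ∈ A) :
    (({m | m ∈ multisetsOfSize a n ∧ ∀ t, m.count t ∈ A}.ncard : ℕ) : ℂ) =
      PowerSeries.coeff n (∏ j ∈ Finset.Icc 1 n, multiplicitySeries A j ^ a j) := by
  lift n to ℕ+ using hn
  rw [ncard_multisets_eq_coeff_prod a A hA
    ((Finset.Icc (1 : ℕ+) n).sigma fun j => (Finset.univ : Finset (Fin (a j))))]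
  · rw [Finset.prod_sigma]
    simp only [Finset.prod_const, Finset.card_univ, Fintype.card_fin]
    congr 1
    refine Finset.prod_bij (fun j _ => (j : ℕ)) (fun j hj => ?_)
      (fun j _ k _ h => PNat.coe_injective h) (fun k hk => ?_) fun _ _ => rfl
    · rw [Finset.mem_Icc] at hj ⊢
      exact ⟨j.pos, PNat.coe_le_coe _ _ |>.2 hj.2⟩
    · rw [Finset.mem_Icc] at hk
      exact ⟨⟨k, hk.1⟩, Finset.mem_Icc.2 ⟨one_le, PNat.coe_le_coe _ _ |>.1 hk.2⟩, rfl⟩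
  · intro t
    simp only [Finset.mem_sigma, Finset.mem_Icc, Finset.mem_univ, and_true, one_le, true_and,
      PNat.coe_le_coe]

theorem multisetCount_eq_coeff (a : ℕ → ℕ) {n : ℕ} (hn : 1 ≤ n) :
    (multisetCount a n : ℂ) =
      PowerSeries.coeff n (∏ j ∈ Finset.Icc 1 n, multiplicitySeries Set.univ j ^ a j) := by
  rw [← ncard_multisets_eq_coeff a hn _ (Set.mem_univ 0)]
  simp [multisetCount]

theorem selectionCount_eq_coeff (a : ℕ → ℕ) {n : ℕ} (hn : 1 ≤ n) :
    (selectionCount a n : ℂ) =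
      PowerSeries.coeff n (∏ j ∈ Finset.Icc 1 n, multiplicitySeries (Set.Iic 1) j ^ a j) := by
  rw [← ncard_multisets_eq_coeff a hn _ (by simp)]
  simp only [selectionCount, selectionsOfSize, Multiset.nodup_iff_count_le_one, Set.mem_Iic]

/-! ### Absolute convergence and Cauchy's coefficient formula -/

/-- The power series `p` converges absolutely at `x`, with sum `v`. -/
def HasAbsSumAt (p : PowerSeries ℂ) (x v : ℂ) : Prop :=
  Summable (fun k => ‖PowerSeries.coeff k p * x ^ k‖) ∧
    HasSum (fun k => PowerSeries.coeff k p * x ^ k) v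

namespace HasAbsSumAt

theorem one (x : ℂ) : HasAbsSumAt 1 x 1 := by
  have h : ∀ k, k ≠ 0 → PowerSeries.coeff k (1 : PowerSeries ℂ) * x ^ k = 0 := fun k hk => by
    rw [PowerSeries.coeff_one, if_neg hk, zero_mul]
  refine ⟨summable_of_ne_finset_zero (s := {0}) fun k hk => ?_, ?_⟩
  · rw [h k (by simpa using hk), norm_zero]
  · simpa using hasSum_single 0 h

theorem mul {p q : PowerSeries ℂ} {x v w : ℂ} (hp : HasAbsSumAt p x v) (hq : HasAbsSumAt q x w) :
    HasAbsSumAt (p * q) x (v * w) := by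
  have h : ∀ n, PowerSeries.coeff n (p * q) * x ^ n =
      ∑ kl ∈ Finset.HasAntidiagonal.antidiagonal n, PowerSeries.coeff kl.1 p * x ^ kl.1 *
        (PowerSeries.coeff kl.2 q * x ^ kl.2) := by
    intro n
    rw [PowerSeries.coeff_mul, Finset.sum_mul]
    refine Finset.sum_congr rfl fun kl hkl => ?_
    rw [← Finset.HasAntidiagonal.mem_antidiagonal.1 hkl, pow_add]
    ring
  have hs := summable_norm_sum_mul_antidiagonal_of_summable_norm hp.1 hq.1
  refine ⟨by simpa only [h] using hs, ?_⟩
  simp only [h]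
  have := tsum_mul_tsum_eq_tsum_sum_antidiagonal_of_summable_norm hp.1 hq.1
  rw [hp.2.tsum_eq, hq.2.tsum_eq] at this
  rw [this]
  exact hs.of_norm.hasSum

theorem pow {p : PowerSeries ℂ} {x v : ℂ} (hp : HasAbsSumAt p x v) (k : ℕ) :
    HasAbsSumAt (p ^ k) x (v ^ k) := by
  induction k with
  | zero => simpa using one x
  | succ k ih => simpa only [pow_succ] using ih.mul hp

theorem prod {ι : Type*} (s : Finset ι) {p : ι → PowerSeries ℂ} {x : ℂ} {v : ι → ℂ}
    (h : ∀ i ∈ s, HasAbsSumAt (p i) x (v i)) : HasAbsSumAt (∏ i ∈ s, p i) x (∏ i ∈ s, v i) := by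
  classical
  induction s using Finset.induction_on with
  | empty => simpa using one x
  | insert i s hi ih =>
    rw [Finset.prod_insert hi, Finset.prod_insert hi]
    exact (h i (Finset.mem_insert_self i s)).mul
      (ih fun k hk => h k (Finset.mem_insert_of_mem hk))

/-- The coefficients live on the multiples of j, so reindexing along the injection k ↦ jk reduces
the claim to a series in x^j. -/
theorem multiplicitySeries {A : Set ℕ} {j : ℕ} (hj : 1 ≤ j) {x v : ℂ}
    (hs : Summable fun k => ‖A.indicator (fun k => (x ^ j) ^ k) k‖)
    (hv : HasSum (A.indicator fun k => (x ^ j) ^ k) v) :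
    HasAbsSumAt (multiplicitySeries A j) x v := by
  classical
  have hinj : Function.Injective fun k : ℕ => j * k :=
    fun k l h => Nat.eq_of_mul_eq_mul_left hj h
  have h0 : ∀ m ∉ Set.range fun k : ℕ => j * k,
      PowerSeries.coeff m (_root_.multiplicitySeries A j) * x ^ m = 0 := by
    intro m hm
    rw [_root_.multiplicitySeries, PowerSeries.coeff_mk, if_neg, zero_mul]
    rintro ⟨k, -, rfl⟩
    exact hm ⟨k, rfl⟩
  have h1 : ∀ k, PowerSeries.coeff (j * k) (_root_.multiplicitySeries A j) * x ^ (j * k) =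
      A.indicator (fun k => (x ^ j) ^ k) k := by
    intro k
    rw [_root_.multiplicitySeries, PowerSeries.coeff_mk, Set.indicator_apply, pow_mul]
    by_cases hk : k ∈ A
    · rw [if_pos ⟨k, hk, rfl⟩, if_pos hk, one_mul]
    · rw [if_neg, if_neg hk, zero_mul]
      rintro ⟨l, hl, h⟩
      exact hk (hinj h ▸ hl)
  constructor
  · rw [← hinj.summable_iff fun m hm => by rw [h0 m hm, norm_zero]]
    refine hs.congr fun k => ?_
    simp only [Function.comp, h1]
  · rw [← hinj.hasSum_iff h0]
    rw [show ((fun m => PowerSeries.coeff m (_root_.multiplicitySeries A j) * x ^ m) ∘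
      fun k => j * k) = A.indicator fun k => (x ^ j) ^ k from funext h1]
    exact hv

theorem multiplicitySeries_univ {j : ℕ} (hj : 1 ≤ j) {x : ℂ} (hx : ‖x‖ < 1) :
    HasAbsSumAt (_root_.multiplicitySeries Set.univ j) x (1 - x ^ j)⁻¹ := by
  have hx' : ‖x ^ j‖ < 1 := by
    rw [norm_pow]; exact pow_lt_one₀ (norm_nonneg _) hx (by omega)
  refine multiplicitySeries hj ?_ ?_
  · simpa only [Set.indicator_univ, norm_pow] using
      summable_geometric_of_lt_one (norm_nonneg (x ^ j)) hx'
  · simpa only [Set.indicator_univ] using hasSum_geometric_of_norm_lt_one hx'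

theorem multiplicitySeries_Iic_one {j : ℕ} (hj : 1 ≤ j) (x : ℂ) :
    HasAbsSumAt (_root_.multiplicitySeries (Set.Iic 1) j) x (1 + x ^ j) := by
  have h : ∀ k ∉ Finset.range 2, (Set.Iic 1).indicator (fun k => (x ^ j) ^ k) k = 0 := by
    intro k hk
    refine Set.indicator_of_notMem (fun h => hk ?_) _
    simp only [Set.mem_Iic] at h
    simp; omega
  refine multiplicitySeries hj (summable_of_ne_finset_zero (s := Finset.range 2) fun k hk => ?_) ?_
  · rw [h k hk, norm_zero]
  · have := hasSum_sum_of_ne_finset_zero (L := SummationFilter.unconditional ℕ) h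
    simpa [Finset.sum_range_succ] using this

/-- Cauchy's coefficient formula on a circle of absolute convergence. -/
theorem coeff_eq_integral {p : PowerSeries ℂ} {σ : ℝ} {F : ℝ → ℂ}
    (h : ∀ θ : ℝ, HasAbsSumAt p (Complex.exp (-σ + θ * Complex.I)) (F θ)) (n : ℕ) :
    PowerSeries.coeff n p = Real.exp (n * σ) / (2 * Real.pi) *
      ∫ θ in (-Real.pi)..Real.pi, F θ * Complex.exp (-(n * θ * Complex.I)) := by
  set g : ℕ → ℝ → ℂ := fun k θ => PowerSeries.coeff k p * Complex.exp (-σ) ^ k *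
    Complex.exp (((k : ℂ) - n) * Complex.I * θ) with hg
  have hgk : ∀ k θ, g k θ = PowerSeries.coeff k p * Complex.exp (-σ + θ * Complex.I) ^ k *
      Complex.exp (-(n * θ * Complex.I)) := by
    intro k θ
    simp only [hg, mul_assoc]
    congr 1
    rw [← Complex.exp_nat_mul, ← Complex.exp_nat_mul, ← Complex.exp_add, ← Complex.exp_add]
    congr 1
    ring
  have hcont : ∀ k, Continuous (g k) := fun k => by simp only [hg]; fun_prop
  have hsum : HasSum (fun k => ∫ θ in (-Real.pi)..Real.pi, g k θ)
      (∫ θ in (-Real.pi)..Real.pi, F θ * Complex.exp (-(n * θ * Complex.I))) := by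
    -- The modulus of the k-th term does not depend on θ, so absolute convergence at θ = 0 serves as
    -- domination on the whole circle.
    refine intervalIntegral.hasSum_integral_of_dominated_convergence
      (bound := fun k _ => ‖PowerSeries.coeff k p * Complex.exp (-σ + (0 : ℝ) * Complex.I) ^ k‖)
      (fun k => (hcont k).aestronglyMeasurable) (fun k => ?_) ?_ ?_ ?_
    · refine Filter.Eventually.of_forall fun θ _ => le_of_eq ?_
      rw [hgk]
      simp only [norm_mul, norm_pow, Complex.norm_exp]
      simp
    · exact Filter.Eventually.of_forall fun θ _ => (h 0).1
    · exact intervalIntegrable_const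
    · refine Filter.Eventually.of_forall fun θ _ => ?_
      simp only [hgk]
      exact (h θ).2.mul_right _
  -- A non-zero integer frequency integrates to zero over a full period; only k = n survives.
  have hzero : ∀ k, k ≠ n → ∫ θ in (-Real.pi)..Real.pi, g k θ = 0 := by
    intro k hk
    have hc : ((k : ℂ) - n) * Complex.I ≠ 0 :=
      mul_ne_zero (sub_ne_zero.2 (by exact_mod_cast hk)) Complex.I_ne_zero
    simp only [hg]
    rw [intervalIntegral.integral_const_mul, integral_exp_mul_complex hc]
    have : Complex.exp (((k : ℂ) - n) * Complex.I * (Real.pi : ℝ)) =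
        Complex.exp (((k : ℂ) - n) * Complex.I * (-Real.pi : ℝ)) := by
      rw [Complex.exp_eq_exp_iff_exists_int]
      refine ⟨(k : ℤ) - n, ?_⟩
      push_cast
      ring
    rw [this, sub_self, zero_div, mul_zero]
  have hn := (hasSum_single n hzero).unique hsum
  rw [← hn]
  simp only [hg, sub_self, zero_mul, Complex.exp_zero, mul_one]
  rw [intervalIntegral.integral_const]
  have h2 : Complex.exp (n * σ) * Complex.exp (-σ) ^ n = 1 := by
    rw [← Complex.exp_nat_mul, ← Complex.exp_add]
    simp
  have hpi : (Real.pi : ℂ) ≠ 0 := by exact_mod_cast Real.pi_ne_zero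
  rw [Complex.real_smul]
  push_cast
  rw [show Complex.exp (n * σ) / (2 * Real.pi) * ((Real.pi - -Real.pi : ℂ) *
    (PowerSeries.coeff n p * Complex.exp (-σ) ^ n)) =
    (Complex.exp (n * σ) * Complex.exp (-σ) ^ n) * PowerSeries.coeff n p by field_simp; ring,
    h2, one_mul]

end HasAbsSumAt

/-- The selection factors are polynomials, so every real σ is allowed; the geometric series of the
multiset case force σ > 0. -/
theorem selectionCount_eq_integral (a : ℕ → ℕ) {n : ℕ} (hn : 1 ≤ n) (σ : ℝ) :
    (selectionCount a n : ℂ) = Real.exp (n * σ) / (2 * Real.pi) *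
      ∫ θ in (-Real.pi)..Real.pi,
        (∏ j ∈ Finset.Icc 1 n, (1 + Complex.exp (-σ + θ * Complex.I) ^ j) ^ a j) *
          Complex.exp (-(n * θ * Complex.I)) := by
  rw [selectionCount_eq_coeff a hn]
  refine HasAbsSumAt.coeff_eq_integral (fun θ => HasAbsSumAt.prod _ fun j hj => ?_) n
  exact (HasAbsSumAt.multiplicitySeries_Iic_one (Finset.mem_Icc.1 hj).1 _).pow _

theorem multisetCount_eq_integral (a : ℕ → ℕ) {n : ℕ} (hn : 1 ≤ n) {σ : ℝ} (hσ : 0 < σ) :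
    (multisetCount a n : ℂ) = Real.exp (n * σ) / (2 * Real.pi) *
      ∫ θ in (-Real.pi)..Real.pi,
        (∏ j ∈ Finset.Icc 1 n, (1 - Complex.exp (-σ + θ * Complex.I) ^ j)⁻¹ ^ a j) *
          Complex.exp (-(n * θ * Complex.I)) := by
  rw [multisetCount_eq_coeff a hn]
  refine HasAbsSumAt.coeff_eq_integral (fun θ => HasAbsSumAt.prod _ fun j hj => ?_) n
  refine (HasAbsSumAt.multiplicitySeries_univ (Finset.mem_Icc.1 hj).1 ?_).pow _
  rw [Complex.norm_exp]
  simpa using hσ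

/-! ### The sums ∑ j^s e^{-jδ} as δ → 0 -/

open MeasureTheory Set in
-- For real w this is Euler's integral. Both sides are holomorphic in the right half-plane, so the
-- identity theorem extends it.
theorem integral_rpow_mul_cexp_neg_mul_Ioi {s : ℝ} (hs : 0 < s) {w : ℂ} (hw : 0 < w.re) :
    ∫ x in Ioi (0 : ℝ), ((x ^ s : ℝ) : ℂ) * Complex.exp (-(w * x)) =
      Real.Gamma (s + 1) * w ^ (-((s + 1 : ℝ) : ℂ)) := by
  have hU : IsOpen {z : ℂ | 0 < z.re} := isOpen_lt continuous_const Complex.continuous_re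
  have hint : ∀ {p c : ℝ}, 0 < p → 0 < c →
      IntegrableOn (fun x : ℝ => x ^ p * Real.exp (-(c * x))) (Ioi 0) := by
    intro p c hp hc
    simpa [neg_mul] using
      integrableOn_rpow_mul_exp_neg_mul_rpow (s := p) (p := 1) (b := c) (by linarith) one_pos hc
  have hmeas : ∀ p : ℝ, ∀ z : ℂ, AEStronglyMeasurable
      (fun x : ℝ => ((x ^ p : ℝ) : ℂ) * Complex.exp (-(z * x))) (volume.restrict (Ioi 0)) := by
    intro p z
    refine Measurable.aestronglyMeasurable ?_
    fun_prop
  have hnorm : ∀ p : ℝ, ∀ z : ℂ, ∀ x ∈ Ioi (0 : ℝ),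
      ‖((x ^ p : ℝ) : ℂ) * Complex.exp (-(z * x))‖ = x ^ p * Real.exp (-(z.re * x)) := by
    intro p z x hx
    rw [norm_mul, Complex.norm_real, Complex.norm_exp,
      Real.norm_of_nonneg (Real.rpow_nonneg (le_of_lt hx) _)]
    simp
  have hdiff : DifferentiableOn ℂ
      (fun z : ℂ => ∫ x in Ioi (0 : ℝ), ((x ^ s : ℝ) : ℂ) * Complex.exp (-(z * x)))
      {z : ℂ | 0 < z.re} := by
    intro z hz
    have hz' : 0 < z.re := hz
    -- On this half-plane the derivative of the integrand is dominated by x^{s+1} e^{-x Re(z)/2},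
    -- uniformly in v.
    have hnhds : {v : ℂ | z.re / 2 < v.re} ∈ nhds z :=
      (isOpen_lt continuous_const Complex.continuous_re).mem_nhds (by
        change z.re / 2 < z.re; linarith)
    refine (hasDerivAt_integral_of_dominated_loc_of_deriv_le
      (F' := fun v x => ((x ^ s : ℝ) : ℂ) * (Complex.exp (-(v * x)) * -(x : ℂ)))
      (bound := fun x => x ^ (s + 1) * Real.exp (-(z.re / 2 * x))) hnhds
      (Eventually.of_forall fun v => hmeas s v) ?_ ?_ ?_ (hint (by linarith) (by linarith)) ?_).2
      |>.differentiableAt.differentiableWithinAt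
    · refine (integrable_norm_iff (hmeas s z)).1 ?_
      exact (hint hs hz').congr_fun (fun x hx => (hnorm s z x hx).symm) measurableSet_Ioi
    · refine Measurable.aestronglyMeasurable ?_
      fun_prop
    · refine (ae_restrict_iff' measurableSet_Ioi).2 (Eventually.of_forall fun x hx v hv => ?_)
      have hx' : (0 : ℝ) < x := hx
      rw [← mul_assoc, norm_mul, hnorm s v x hx, norm_neg, Complex.norm_real,
        Real.norm_of_nonneg hx'.le, Real.rpow_add_one hx'.ne', mul_right_comm]
      have : Real.exp (-(v.re * x)) ≤ Real.exp (-(z.re / 2 * x)) := by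
        refine Real.exp_le_exp.2 (neg_le_neg (mul_le_mul_of_nonneg_right (le_of_lt hv) hx'.le))
      gcongr
    · refine Eventually.of_forall fun x v _ => ?_
      have h1 : HasDerivAt (fun v : ℂ => -(v * x)) (-(x : ℂ)) v := by
        simpa using ((hasDerivAt_id v).mul_const (x : ℂ)).fun_neg
      exact h1.cexp.const_mul _
  have hdiff2 : DifferentiableOn ℂ
      (fun z : ℂ => Real.Gamma (s + 1) * z ^ (-((s + 1 : ℝ) : ℂ))) {z : ℂ | 0 < z.re} := by
    intro z hz
    refine DifferentiableAt.differentiableWithinAt ?_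
    exact (differentiableAt_id.cpow_const (Or.inl hz)).const_mul _
  have hreal : ∀ c : ℝ, 0 < c →
      ∫ x in Ioi (0 : ℝ), ((x ^ s : ℝ) : ℂ) * Complex.exp (-((c : ℂ) * x)) =
      Real.Gamma (s + 1) * (c : ℂ) ^ (-((s + 1 : ℝ) : ℂ)) := by
    intro c hc
    have := Real.integral_rpow_mul_exp_neg_mul_Ioi (a := s + 1) (r := c) (by linarith) hc
    rw [add_sub_cancel_right] at this
    have h2 : (c : ℂ) ^ (-((s + 1 : ℝ) : ℂ)) = (((1 / c) ^ (s + 1) : ℝ) : ℂ) := by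
      rw [← Complex.ofReal_neg, ← Complex.ofReal_cpow hc.le, Real.rpow_neg hc.le, one_div,
        Real.inv_rpow hc.le]
    rw [h2, mul_comm, ← Complex.ofReal_mul, ← this, ← integral_complex_ofReal]
    refine integral_congr_ae (Eventually.of_forall fun x => ?_)
    push_cast
    rfl
  refine AnalyticOnNhd.eqOn_of_preconnected_of_frequently_eq (hdiff.analyticOnNhd hU)
    (hdiff2.analyticOnNhd hU) (convex_halfSpace_re_gt 0).isPreconnected
    (z₀ := 1) (by simp) ?_ hw
  -- The real points 1 + 1/(k+1) accumulate at 1 without reaching it.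
  have ht : Tendsto (fun k : ℕ => ((1 + ((k : ℝ) + 1)⁻¹ : ℝ) : ℂ)) atTop (nhdsWithin 1 {1}ᶜ) := by
    refine tendsto_nhdsWithin_iff.2 ⟨?_, Eventually.of_forall fun k => ?_⟩
    · have h1 : Tendsto (fun k : ℕ => 1 + ((k : ℝ) + 1)⁻¹) atTop (nhds (1 + 0)) :=
        tendsto_const_nhds.add (by simpa using tendsto_one_div_add_atTop_nhds_zero_nat (𝕜 := ℝ))
      rw [add_zero] at h1
      have h2 := (Complex.continuous_ofReal.tendsto 1).comp h1
      rw [Complex.ofReal_one] at h2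
      exact h2
    · have : ((k : ℝ) + 1)⁻¹ ≠ 0 := by positivity
      simp only [mem_compl_iff, mem_singleton_iff]
      norm_cast
      simpa using this
  exact ht.frequently (Frequently.of_forall fun k => hreal _ (by positivity))

/-- The summand `j^s e^{-jδ}`, with value `0` at `j = 0`. -/
noncomputable def powExp (s δ : ℝ) (j : ℕ) : ℝ :=
  if j = 0 then 0 else (j : ℝ) ^ s * Real.exp (-(j * δ))

theorem powExp_nonneg (s δ : ℝ) (j : ℕ) : 0 ≤ powExp s δ j := by
  unfold powExp; split_ifs <;> positivity

theorem powExp_of_ne_zero (s δ : ℝ) {j : ℕ} (hj : j ≠ 0) :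
    powExp s δ j = (j : ℝ) ^ s * Real.exp (-(j * δ)) := if_neg hj

theorem summable_powExp (s : ℝ) {δ : ℝ} (hδ : 0 < δ) : Summable (powExp s δ) := by
  refine summable_of_isBigO_nat (Real.summable_nat_rpow.2 (by norm_num : (-2 : ℝ) < -1)) ?_
  have h1 := (isLittleO_exp_neg_mul_rpow_atTop hδ (-2 - s)).isBigO.comp_tendsto
    tendsto_natCast_atTop_atTop
  have h2 := (isBigO_refl (fun n : ℕ => (n : ℝ) ^ s) atTop).mul h1
  refine (h2.congr' ?_ ?_)
  · filter_upwards [eventually_ne_atTop 0] with j hj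
    rw [powExp_of_ne_zero _ _ hj]
    simp [mul_comm]
  · filter_upwards [eventually_gt_atTop 0] with j hj
    simp only [Function.comp]
    rw [← Real.rpow_add (by exact_mod_cast hj)]
    congr 1; ring

theorem powExp_le_powExp_add {s δ : ℝ} {c : ℝ} (hc : 0 ≤ c) (j : ℕ) :
    powExp s δ j ≤ powExp (s + c) δ j := by
  unfold powExp
  split_ifs with hj
  · exact le_rfl
  · have : (1 : ℝ) ≤ j := by exact_mod_cast Nat.one_le_iff_ne_zero.2 hj
    gcongr
    linarith

theorem powExp_anti {s δ δ' : ℝ} (h : δ ≤ δ') (j : ℕ) : powExp s δ' j ≤ powExp s δ j := by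
  unfold powExp
  split_ifs with hj
  · exact le_rfl
  · gcongr

theorem sum_Icc_powExp_le_tsum (s : ℝ) {δ : ℝ} (hδ : 0 < δ) (n : ℕ) :
    ∑ j ∈ Finset.Icc 1 n, powExp s δ j ≤ ∑' j, powExp s δ j :=
  (summable_powExp s hδ).sum_le_tsum _ fun j _ => powExp_nonneg s δ j

/-- In the tail j > n, half of the exponential decay is at most e^{-nδ/2}; the other half keeps the
series convergent. -/
theorem tsum_powExp_sub_sum_Icc_le (s : ℝ) {δ : ℝ} (hδ : 0 < δ) (n : ℕ) :
    ∑' j, powExp s δ j - ∑ j ∈ Finset.Icc 1 n, powExp s δ j ≤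
      Real.exp (-(n * (δ / 2))) * ∑' j, powExp s (δ / 2) j := by
  have h1 : HasSum (fun j => if j ∈ Finset.Icc 1 n then powExp s δ j else 0)
      (∑ j ∈ Finset.Icc 1 n, powExp s δ j) := by
    rw [← Finset.sum_congr rfl fun j hj => if_pos (t := powExp s δ j) (e := 0) hj]
    exact hasSum_sum_of_ne_finset_zero fun j hj => if_neg hj
  have h2 := (summable_powExp s hδ).hasSum.sub h1
  refine hasSum_le (fun j => ?_) h2 ((summable_powExp s (half_pos hδ)).hasSum.mul_left _)
  have h0 : 0 ≤ Real.exp (-(n * (δ / 2))) * powExp s (δ / 2) j :=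
    mul_nonneg (Real.exp_pos _).le (powExp_nonneg _ _ _)
  split_ifs with hj
  · simpa using h0
  · rw [sub_zero]
    rcases Nat.eq_zero_or_pos j with rfl | hj0
    · simp [powExp]
    · have hjn : (n : ℝ) ≤ j := by
        rw [Finset.mem_Icc] at hj
        exact_mod_cast (by omega : n ≤ j)
      rw [powExp_of_ne_zero _ _ hj0.ne', powExp_of_ne_zero _ _ hj0.ne', mul_left_comm,
        ← Real.exp_add]
      gcongr
      nlinarith

open MeasureTheory Set FourierTransform in
-- For s > 0 the truncation `max x 0` makes the profile continuous on the whole line and zero for x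
-- ≤ 0, as Poisson summation needs.
theorem fourier_rpow_mul_exp {s δ : ℝ} (hs : 0 < s) (hδ : 0 < δ) (ξ : ℝ) :
    𝓕 (fun x : ℝ => (((max x 0) ^ s * Real.exp (-(δ * x)) : ℝ) : ℂ)) ξ =
      Real.Gamma (s + 1) * ((δ : ℂ) + 2 * Real.pi * ξ * Complex.I) ^ (-((s + 1 : ℝ) : ℂ)) := by
  rw [Real.fourier_real_eq_integral_exp_smul, ← integral_rpow_mul_cexp_neg_mul_Ioi hs (by simpa),
    ← integral_indicator measurableSet_Ioi]
  refine integral_congr_ae (Eventually.of_forall fun x => ?_)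
  simp only [smul_eq_mul]
  by_cases hx : x ∈ Ioi (0 : ℝ)
  · rw [indicator_of_mem hx, max_eq_left (le_of_lt hx)]
    push_cast
    rw [mul_left_comm, ← Complex.exp_add]
    congr 2
    ring
  · rw [indicator_of_notMem hx, max_eq_right (not_lt.1 hx), Real.zero_rpow hs.ne']
    simp

open MeasureTheory Set FourierTransform in
/-- Poisson summation bounds the difference between the sum and the integral of `x^s e^{-δx}`. -/
theorem exists_abs_tsum_powExp_sub_le {s : ℝ} (hs : 0 < s) :
    ∃ C, ∀ δ, 0 < δ →
      |∑' j, powExp s δ j - Real.Gamma (s + 1) * δ ^ (-(s + 1))| ≤ C := by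
  have hsum : Summable fun n : ℤ =>
      Real.Gamma (s + 1) * ((2 * Real.pi) ^ (-(s + 1)) * |(n : ℝ)| ^ (-(s + 1))) :=
    ((Real.summable_abs_int_rpow (by linarith : 1 < s + 1)).mul_left _).mul_left _
  refine ⟨∑' n : ℤ, Real.Gamma (s + 1) * ((2 * Real.pi) ^ (-(s + 1)) * |(n : ℝ)| ^ (-(s + 1))),
    fun δ hδ => ?_⟩
  set f : ℝ → ℂ := fun x : ℝ => (((max x 0) ^ s * Real.exp (-(δ * x)) : ℝ) : ℂ) with hf
  have hΓ : 0 < Real.Gamma (s + 1) := Real.Gamma_pos_of_pos (by linarith)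
  have hF : ∀ ξ : ℝ, 𝓕 f ξ = Real.Gamma (s + 1) *
      ((δ : ℂ) + 2 * Real.pi * ξ * Complex.I) ^ (-((s + 1 : ℝ) : ℂ)) := fourier_rpow_mul_exp hs hδ
  -- Bounding |δ + 2πiξ| below by its imaginary part removes δ, which makes the final constant
  -- uniform.
  have hFb : ∀ ξ : ℝ, ξ ≠ 0 →
      ‖𝓕 f ξ‖ ≤ Real.Gamma (s + 1) * ((2 * Real.pi) ^ (-(s + 1)) * |ξ| ^ (-(s + 1))) := by
    intro ξ hξ
    rw [hF, norm_mul, Complex.norm_real, Real.norm_of_nonneg hΓ.le, ← Complex.ofReal_neg,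
      Complex.norm_cpow_real, ← Real.mul_rpow (by positivity) (abs_nonneg _)]
    refine mul_le_mul_of_nonneg_left ?_ hΓ.le
    refine Real.rpow_le_rpow_of_nonpos (by positivity) ?_ (by linarith)
    refine le_trans (le_of_eq ?_) (Complex.abs_im_le_norm _)
    simp [abs_mul, abs_of_pos Real.pi_pos]
  have hcont : Continuous f := by
    refine Complex.continuous_ofReal.comp (Continuous.mul ?_ (by fun_prop))
    exact (continuous_id.max continuous_const).rpow_const fun _ => Or.inr hs.le
  have hfO : f =O[cocompact ℝ] (|·| ^ (-(s + 1))) := by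
    rw [cocompact_eq_atBot_atTop, isBigO_sup]
    constructor
    · refine (isBigO_zero _ _).congr' ?_ EventuallyEq.rfl
      filter_upwards [eventually_le_atBot 0] with x hx
      simp [hf, max_eq_right hx, Real.zero_rpow hs.ne']
    · have h1 := (isLittleO_exp_neg_mul_rpow_atTop hδ (-(s + 1) - s)).isBigO
      have h2 := (isBigO_refl (fun x : ℝ => x ^ s) atTop).mul h1
      refine IsBigO.of_norm_left (h2.congr' ?_ ?_)
      · filter_upwards [eventually_ge_atTop 0] with x hx
        rw [hf, Complex.norm_real, max_eq_left hx, Real.norm_of_nonneg (by positivity), neg_mul]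
      · filter_upwards [eventually_gt_atTop 0] with x hx
        rw [← Real.rpow_add hx, abs_of_pos hx]
        congr 1; ring
  have hFO : (𝓕 f) =O[cocompact ℝ] (|·| ^ (-(s + 1))) := by
    refine IsBigO.of_bound (Real.Gamma (s + 1) * (2 * Real.pi) ^ (-(s + 1))) ?_
    have h0 : ∀ᶠ ξ : ℝ in cocompact ℝ, ξ ≠ 0 := by
      have := (isCompact_singleton (x := (0 : ℝ))).compl_mem_cocompact
      filter_upwards [this] with ξ hξ using hξ
    filter_upwards [h0] with ξ hξ
    rw [Real.norm_of_nonneg (by positivity), mul_assoc]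
    exact hFb ξ hξ
  -- The frequency 0 gives the main term Γ(s+1) δ^{-(s+1)}; the remaining frequencies form the
  -- bounded error.
  have hP := Real.tsum_eq_tsum_fourier_of_rpow_decay hcont (by linarith : 1 < s + 1) hfO hFO 0
  simp only [zero_add, QuotientAddGroup.mk_zero, fourier_eval_zero, mul_one] at hP
  have hFs : Summable fun n : ℤ => 𝓕 f n := summable_of_isBigO
    (Real.summable_abs_int_rpow (by linarith : 1 < s + 1))
    (hFO.comp_tendsto Int.tendsto_coe_cofinite)
  have hL : ∑' n : ℤ, f n = ((∑' j, powExp s δ j : ℝ) : ℂ) := by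
    rw [Complex.ofReal_tsum, ← Function.Injective.tsum_eq (f := fun n : ℤ => f n)
      (g := ((↑) : ℕ → ℤ)) Nat.cast_injective]
    · refine tsum_congr fun j => ?_
      rcases eq_or_ne j 0 with rfl | hj
      · simp [hf, powExp, Real.zero_rpow hs.ne']
      · rw [powExp_of_ne_zero _ _ hj]
        simp [hf, mul_comm]
    · intro n hn
      by_contra hc
      refine hn ?_
      have : n < 0 := by
        by_contra h
        exact hc ⟨n.toNat, by simp; omega⟩
      have h' : (n : ℝ) ≤ 0 := by exact_mod_cast this.le
      simp [hf, max_eq_right h', Real.zero_rpow hs.ne']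
  have h0 : 𝓕 f (0 : ℤ) = ((Real.Gamma (s + 1) * δ ^ (-(s + 1)) : ℝ) : ℂ) := by
    rw [hF]
    push_cast
    rw [Complex.ofReal_cpow hδ.le]
    simp
  rw [hL, hFs.tsum_eq_add_tsum_ite 0, h0, ← sub_eq_iff_eq_add', ← Complex.ofReal_sub] at hP
  rw [← Real.norm_eq_abs, ← Complex.norm_real, hP]
  refine tsum_of_norm_bounded hsum.hasSum fun n => ?_
  split_ifs with hn
  · rw [norm_zero]; positivity
  · exact hFb n (by exact_mod_cast hn)

theorem tendsto_tsum_powExp_mul_rpow {s : ℝ} (hs : 0 < s) :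
    Tendsto (fun δ => (∑' j, powExp s δ j) * δ ^ (s + 1)) (nhdsWithin 0 (Set.Ioi 0))
      (nhds (Real.Gamma (s + 1))) := by
  obtain ⟨C, hC⟩ := exists_abs_tsum_powExp_sub_le hs
  rw [tendsto_iff_norm_sub_tendsto_zero]
  have h1 : Tendsto (fun δ : ℝ => C * δ ^ (s + 1)) (nhdsWithin 0 (Set.Ioi 0)) (nhds 0) := by
    have : Tendsto (fun δ : ℝ => C * δ ^ (s + 1)) (nhds 0) (nhds (C * 0 ^ (s + 1))) :=
      (Real.continuousAt_rpow_const 0 (s + 1) (Or.inr (by linarith))).tendsto.const_mul C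
    rw [Real.zero_rpow (by linarith), mul_zero] at this
    exact this.mono_left nhdsWithin_le_nhds
  refine squeeze_zero' (Eventually.of_forall fun δ => norm_nonneg _) ?_ h1
  filter_upwards [self_mem_nhdsWithin] with δ hδ
  have hδ : 0 < δ := hδ
  have h2 : (∑' j, powExp s δ j) * δ ^ (s + 1) - Real.Gamma (s + 1) =
      (∑' j, powExp s δ j - Real.Gamma (s + 1) * δ ^ (-(s + 1))) * δ ^ (s + 1) := by
    rw [sub_mul, mul_assoc, ← Real.rpow_add hδ]
    simp
  rw [h2, norm_mul, Real.norm_of_nonneg (Real.rpow_nonneg hδ.le (s + 1))]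
  exact mul_le_mul_of_nonneg_right (hC δ hδ) (by positivity)

theorem hasDerivAt_tsum_powExp (s : ℝ) {δ : ℝ} (hδ : 0 < δ) :
    HasDerivAt (fun δ => ∑' j, powExp s δ j) (-∑' j, powExp (s + 1) δ j) δ := by
  rw [← tsum_neg]
  have hmem : δ ∈ Set.Ioi (δ / 2) := by rw [Set.mem_Ioi]; linarith
  refine hasDerivAt_tsum_of_isPreconnected (g := fun j δ => powExp s δ j)
    (g' := fun j δ => -powExp (s + 1) δ j) (summable_powExp (s + 1) (half_pos hδ))
    isOpen_Ioi isPreconnected_Ioi (fun j x _ => ?_) (fun j x hx => ?_)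
    hmem (summable_powExp s hδ) hmem
  · by_cases hj : j = 0
    · simp [powExp, hj, hasDerivAt_const]
    · simp only [powExp_of_ne_zero _ _ hj]
      have h1 : HasDerivAt (fun x : ℝ => -((j : ℝ) * x)) (-(j : ℝ)) x := by
        simpa using ((hasDerivAt_id x).const_mul (j : ℝ)).fun_neg
      convert! h1.exp.const_mul ((j : ℝ) ^ s) using 1
      rw [Real.rpow_add_one (by exact_mod_cast hj)]
      ring
  · rw [norm_neg, Real.norm_of_nonneg (powExp_nonneg _ _ _)]
    exact powExp_anti (le_of_lt hx) j

/-- The exponent r - 1 may be negative, where the Poisson argument fails. But the derivative of the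
difference is, up to sign, the error term for the exponent r, which is bounded; the difference is
therefore Lipschitz on (0, ∞) and extends continuously to 0. -/
theorem exists_tendsto_tsum_powExp_sub {r : ℝ} (hr : 0 < r) :
    ∃ c, Tendsto (fun δ => ∑' j, powExp (r - 1) δ j - Real.Gamma r * δ ^ (-r))
      (nhdsWithin 0 (Set.Ioi 0)) (nhds c) := by
  obtain ⟨C, hC⟩ := exists_abs_tsum_powExp_sub_le hr
  set g : ℝ → ℝ := fun δ => ∑' j, powExp (r - 1) δ j - Real.Gamma r * δ ^ (-r) with hg
  have hd : ∀ δ, 0 < δ → HasDerivAt g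
      (-(∑' j, powExp r δ j - Real.Gamma (r + 1) * δ ^ (-(r + 1)))) δ := by
    intro δ hδ
    have h1 := hasDerivAt_tsum_powExp (r - 1) hδ
    have h2 := (Real.hasDerivAt_rpow_const (p := -r) (Or.inl hδ.ne')).const_mul (Real.Gamma r)
    convert! h1.sub h2 using 1
    rw [Real.Gamma_add_one hr.ne', sub_add_cancel, neg_add, ← sub_eq_add_neg]
    ring
  have hC0 : 0 ≤ C := (abs_nonneg _).trans (hC 1 one_pos)
  have hlip : LipschitzOnWith C.toNNReal g (Set.Ioi 0) := by
    refine (convex_Ioi 0).lipschitzOnWith_of_nnnorm_hasDerivWithin_le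
      (fun δ hδ => (hd δ hδ).hasDerivWithinAt) fun δ hδ => ?_
    rw [← NNReal.coe_le_coe, coe_nnnorm, norm_neg, Real.coe_toNNReal C hC0]
    exact hC δ hδ
  obtain ⟨G, hG, hGg⟩ := hlip.extend_real
  refine ⟨G 0, ?_⟩
  refine ((hG.continuous.tendsto 0).mono_left nhdsWithin_le_nhds).congr' ?_
  filter_upwards [self_mem_nhdsWithin] with δ hδ using (hGg hδ).symm

theorem powExp_add_one (s δ : ℝ) (j : ℕ) : powExp (s + 1) δ j = powExp s δ j * j := by
  unfold powExp
  split_ifs with hj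
  · rw [zero_mul]
  · rw [Real.rpow_add_one (by exact_mod_cast hj)]
    ring

/-! ### Lower bounds for weighted sums of 1 - cos(jθ) -/

theorem two_sin_half_mul_sum_cos (θ : ℝ) {N M : ℕ} (h : N ≤ M) :
    2 * Real.sin (θ / 2) * ∑ j ∈ Finset.Ico N M, Real.cos (j * θ) =
      Real.sin ((M - 1 / 2) * θ) - Real.sin ((N - 1 / 2) * θ) := by
  induction M, h using Nat.le_induction with
  | base => simp
  | succ M h ih =>
    rw [Finset.sum_Ico_succ_top h, mul_add, ih]
    have h1 : ((M + 1 : ℕ) - 1 / 2 : ℝ) * θ = M * θ + θ / 2 := by push_cast; ring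
    have h2 : ((M : ℝ) - 1 / 2) * θ = M * θ - θ / 2 := by ring
    rw [h1, h2, Real.sin_add, Real.sin_sub]
    ring

/-- If |θ|N ≤ 1, each term with N ≤ j < 2N is at least 2(jθ)²/π² ≥ (jθ)²/5. Otherwise the telescoped
cosine sum is at most π/|θ| ≤ πN in modulus, and the block has 5N + 1 terms with 5 > π, so a
positive proportion of N remains. -/
theorem le_sum_one_sub_cos {N : ℕ} (hN : 1 ≤ N) {θ : ℝ} (hθ : |θ| ≤ Real.pi) :
    1 / 5 * min ((N : ℝ) ^ 3 * θ ^ 2) N ≤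
      ∑ j ∈ Finset.Ico N (6 * N + 1), (1 - Real.cos (j * θ)) := by
  have hN' : (1 : ℝ) ≤ N := by exact_mod_cast hN
  have hpi := Real.pi_lt_d2
  have hpi3 := Real.pi_gt_three
  rcases le_or_gt (|θ| * N) 1 with h | h
  · have hsub : Finset.Ico N (2 * N) ⊆ Finset.Ico N (6 * N + 1) :=
      Finset.Ico_subset_Ico le_rfl (by omega)
    have h1 : ∀ j ∈ Finset.Ico N (2 * N), 1 / 5 * ((N : ℝ) ^ 2 * θ ^ 2) ≤ 1 - Real.cos (j * θ) := by
      intro j hj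
      rw [Finset.mem_Ico] at hj
      have hj1 : (N : ℝ) ≤ j := by exact_mod_cast hj.1
      have hj2 : (j : ℝ) ≤ 2 * N := by exact_mod_cast hj.2.le
      have habs : |j * θ| ≤ Real.pi := by
        rw [abs_mul, Nat.abs_cast]
        nlinarith [abs_nonneg θ]
      have h2 := Real.cos_le_one_sub_mul_cos_sq habs
      have h3 : 1 / 5 ≤ 2 / Real.pi ^ 2 := by
        rw [div_le_div_iff₀ (by norm_num) (by positivity)]
        nlinarith
      have h4 : (N : ℝ) ^ 2 * θ ^ 2 ≤ (j * θ) ^ 2 := by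
        rw [mul_pow]; gcongr
      have h5 : 1 / 5 * ((N : ℝ) ^ 2 * θ ^ 2) ≤ 2 / Real.pi ^ 2 * (j * θ) ^ 2 := by gcongr
      linarith
    calc 1 / 5 * min ((N : ℝ) ^ 3 * θ ^ 2) N ≤ 1 / 5 * ((N : ℝ) ^ 3 * θ ^ 2) := by
          gcongr; exact min_le_left _ _
      _ = ∑ j ∈ Finset.Ico N (2 * N), 1 / 5 * ((N : ℝ) ^ 2 * θ ^ 2) := by
          rw [Finset.sum_const, Nat.card_Ico, nsmul_eq_mul, show 2 * N - N = N by omega]; ring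
      _ ≤ ∑ j ∈ Finset.Ico N (2 * N), (1 - Real.cos (j * θ)) := Finset.sum_le_sum h1
      _ ≤ _ := Finset.sum_le_sum_of_subset_of_nonneg hsub fun j _ _ => by
          linarith [Real.cos_le_one (j * θ)]
  · have hθ0 : 0 < |θ| := by
      by_contra hc
      have : |θ| = 0 := le_antisymm (not_lt.1 hc) (abs_nonneg _)
      rw [this] at h; linarith
    have hsin : |θ| / Real.pi ≤ |Real.sin (θ / 2)| := by
      have := Real.mul_abs_le_abs_sin (x := θ / 2) (by rw [abs_div, abs_two]; linarith)
      refine le_trans (le_of_eq ?_) this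
      rw [abs_div, abs_two]; field_simp
    have htel := two_sin_half_mul_sum_cos θ (N := N) (M := 6 * N + 1) (by omega)
    set S := ∑ j ∈ Finset.Ico N (6 * N + 1), Real.cos (j * θ) with hS
    have hb : 2 * |Real.sin (θ / 2)| * |S| ≤ 2 := by
      have habs := congrArg abs htel
      rw [abs_mul, abs_mul, abs_two] at habs
      rw [habs]
      refine (abs_sub _ _).trans ?_
      linarith [Real.abs_sin_le_one (((6 * N + 1 : ℕ) - 1 / 2 : ℝ) * θ),
        Real.abs_sin_le_one (((N : ℝ) - 1 / 2) * θ)]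
    have h1 : |θ| * |S| ≤ Real.pi := by
      have : |θ| / Real.pi * |S| ≤ 1 := by nlinarith [abs_nonneg S]
      rwa [div_mul_eq_mul_div, div_le_one Real.pi_pos] at this
    have h2 : |S| ≤ Real.pi * N := by
      by_contra hc
      have : |θ| * (Real.pi * N) < |θ| * |S| := mul_lt_mul_of_pos_left (not_le.1 hc) hθ0
      nlinarith
    rw [Finset.sum_sub_distrib, ← hS, Finset.sum_const, Nat.card_Ico, nsmul_eq_mul, mul_one,
      show 6 * N + 1 - N = 5 * N + 1 by omega]
    push_cast
    have h3 : 1 / 5 * min ((N : ℝ) ^ 3 * θ ^ 2) N ≤ N := by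
      linarith [min_le_right ((N : ℝ) ^ 3 * θ ^ 2) (N : ℝ)]
    nlinarith [le_abs_self S]

/-- Only the block N ≤ j ≤ 6N with N = ⌈1/δ⌉ is used. There 1 ≤ jδ ≤ 12, so all weights are at least
a constant times δ^{1-r}, and `le_sum_one_sub_cos` applies. The condition nδ ≥ 12 makes the block
fit below n. -/
theorem exists_le_sum_powExp_mul_one_sub_cos (r : ℝ) :
    ∃ c, 0 < c ∧ ∀ δ : ℝ, 0 < δ → δ ≤ 1 → ∀ n : ℕ, 12 ≤ n * δ → ∀ θ, |θ| ≤ Real.pi →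
      c * min (θ ^ 2 * δ ^ (-(r + 2))) (δ ^ (-r)) ≤
        ∑ j ∈ Finset.Icc 1 n, powExp (r - 1) δ j * (1 - Real.cos (j * θ)) := by
  -- The minimum bounds (jδ)^{r-1} below on [1, 12] for either sign of r - 1, exp(-12) bounds
  -- e^{-jδ}, and 1/5 comes from the cosine sum.
  refine ⟨min 1 (12 ^ (r - 1)) * Real.exp (-12) * (1 / 5), by positivity, ?_⟩
  intro δ hδ hδ1 n hn θ hθ
  set N := ⌈1 / δ⌉₊ with hN
  have hN0 : 1 / δ ≤ N := Nat.le_ceil _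
  have hN1 : 1 ≤ N := Nat.one_le_ceil_iff.2 (by positivity)
  have hNδ : 1 ≤ N * δ := by rwa [div_le_iff₀ hδ] at hN0
  have hNδ2 : N * δ ≤ 2 := by
    have : (N : ℝ) < 1 / δ + 1 := Nat.ceil_lt_add_one (by positivity)
    have : N * δ < (1 / δ + 1) * δ := mul_lt_mul_of_pos_right this hδ
    rw [add_mul, one_div_mul_cancel hδ.ne'] at this
    linarith
  have hNn : 6 * N ≤ n := by
    have : (6 * N : ℝ) * δ ≤ n * δ := by linarith
    exact_mod_cast le_of_mul_le_mul_right this hδ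
  have hsub : Finset.Ico N (6 * N + 1) ⊆ Finset.Icc 1 n := by
    intro j hj
    rw [Finset.mem_Ico] at hj
    rw [Finset.mem_Icc]
    omega
  have hnn : ∀ j : ℕ, 0 ≤ 1 - Real.cos (j * θ) := fun j => by linarith [Real.cos_le_one (j * θ)]
  have hw : ∀ j ∈ Finset.Ico N (6 * N + 1),
      min 1 (12 ^ (r - 1)) * Real.exp (-12) * δ ^ (1 - r) ≤ powExp (r - 1) δ j := by
    intro j hj
    rw [Finset.mem_Ico] at hj
    have hj0 : j ≠ 0 := by omega
    have hj1 : (N : ℝ) ≤ j := by exact_mod_cast hj.1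
    have hj2 : (j : ℝ) ≤ 6 * N := by exact_mod_cast Nat.lt_succ_iff.1 hj.2
    have hjδ1 : 1 ≤ j * δ := hNδ.trans (by gcongr)
    have hjδ2 : j * δ ≤ 12 := by nlinarith
    rw [powExp_of_ne_zero _ _ hj0]
    have h1 : (j : ℝ) ^ (r - 1) = (j * δ) ^ (r - 1) * δ ^ (1 - r) := by
      rw [Real.mul_rpow (by positivity) hδ.le, mul_assoc, ← Real.rpow_add hδ]
      simp
    have h2 : min 1 ((12 : ℝ) ^ (r - 1)) ≤ (j * δ) ^ (r - 1) := by
      rcases le_total 0 (r - 1) with h | h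
      · exact (min_le_left _ _).trans (Real.one_le_rpow hjδ1 h)
      · exact (min_le_right _ _).trans (Real.rpow_le_rpow_of_nonpos (by linarith) hjδ2 h)
    rw [h1, mul_right_comm]
    gcongr
  have hmin : min (θ ^ 2 * δ ^ (-(r + 2))) (δ ^ (-r)) ≤
      δ ^ (1 - r) * min ((N : ℝ) ^ 3 * θ ^ 2) N := by
    rw [mul_min_of_nonneg _ _ (by positivity)]
    refine min_le_min ?_ ?_
    · have h1 : δ ^ (-(r + 2)) = δ ^ (1 - r) * (1 / δ) ^ 3 := by
        rw [one_div, ← Real.rpow_natCast, ← Real.rpow_neg_one, ← Real.rpow_mul hδ.le,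
          ← Real.rpow_add hδ]
        congr 1; push_cast; ring
      rw [h1, mul_comm, mul_assoc]
      gcongr
    · have h1 : δ ^ (-r) = δ ^ (1 - r) * (1 / δ) := by
        rw [one_div, ← Real.rpow_neg_one, ← Real.rpow_add hδ]
        congr 1; ring
      rw [h1]
      gcongr
  calc min 1 (12 ^ (r - 1)) * Real.exp (-12) * (1 / 5) *
        min (θ ^ 2 * δ ^ (-(r + 2))) (δ ^ (-r))
      ≤ min 1 (12 ^ (r - 1)) * Real.exp (-12) * (1 / 5) *
        (δ ^ (1 - r) * min ((N : ℝ) ^ 3 * θ ^ 2) N) := by gcongr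
    _ = min 1 (12 ^ (r - 1)) * Real.exp (-12) * δ ^ (1 - r) *
        (1 / 5 * min ((N : ℝ) ^ 3 * θ ^ 2) N) := by ring
    _ ≤ min 1 (12 ^ (r - 1)) * Real.exp (-12) * δ ^ (1 - r) *
        ∑ j ∈ Finset.Ico N (6 * N + 1), (1 - Real.cos (j * θ)) := by
        gcongr; exact le_sum_one_sub_cos hN1 hθ
    _ = ∑ j ∈ Finset.Ico N (6 * N + 1), min 1 (12 ^ (r - 1)) * Real.exp (-12) * δ ^ (1 - r) *
        (1 - Real.cos (j * θ)) := Finset.mul_sum _ _ _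
    _ ≤ ∑ j ∈ Finset.Ico N (6 * N + 1), powExp (r - 1) δ j * (1 - Real.cos (j * θ)) :=
        Finset.sum_le_sum fun j hj => mul_le_mul_of_nonneg_right (hw j hj) (hnn j)
    _ ≤ _ := Finset.sum_le_sum_of_subset_of_nonneg hsub fun j _ _ =>
        mul_nonneg (powExp_nonneg _ _ _) (hnn j)

/-- At θ = δ both arms of the minimum in the cosine estimate equal δ^{-r}, and 1 - cos x ≤ x²/2
turns the cosine sum into the second-moment sum. -/
theorem exists_le_sum_powExp_add_one (r : ℝ) :
    ∃ c, 0 < c ∧ ∀ δ : ℝ, 0 < δ → δ ≤ 1 → ∀ n : ℕ, 12 ≤ n * δ →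
      c * δ ^ (-(r + 2)) ≤ ∑ j ∈ Finset.Icc 1 n, powExp (r + 1) δ j := by
  obtain ⟨c, hc, h⟩ := exists_le_sum_powExp_mul_one_sub_cos r
  refine ⟨2 * c, by positivity, fun δ hδ hδ1 n hn => ?_⟩
  have h1 := h δ hδ hδ1 n hn δ (by rw [abs_of_pos hδ]; linarith [Real.pi_gt_three])
  have h2 : δ ^ 2 * δ ^ (-(r + 2)) = δ ^ (-r) := by
    rw [← Real.rpow_natCast, ← Real.rpow_add hδ]
    congr 1; push_cast; ring
  rw [h2, min_self] at h1
  have h3 : ∑ j ∈ Finset.Icc 1 n, powExp (r - 1) δ j * (1 - Real.cos (j * δ)) ≤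
      δ ^ 2 / 2 * ∑ j ∈ Finset.Icc 1 n, powExp (r + 1) δ j := by
    rw [Finset.mul_sum]
    refine Finset.sum_le_sum fun j _ => ?_
    have h4 := Real.one_sub_sq_div_two_le_cos (x := j * δ)
    have h5 : powExp (r + 1) δ j = powExp (r - 1) δ j * j * j := by
      rw [← powExp_add_one, sub_add_cancel, powExp_add_one]
    rw [h5]
    have h6 := powExp_nonneg (r - 1) δ j
    calc _ ≤ powExp (r - 1) δ j * ((j * δ) ^ 2 / 2) := by
          refine mul_le_mul_of_nonneg_left (by linarith) h6
      _ = _ := by ring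
  have h7 : c * (δ ^ 2 * δ ^ (-(r + 2))) ≤
      δ ^ 2 / 2 * ∑ j ∈ Finset.Icc 1 n, powExp (r + 1) δ j := by rw [h2]; exact h1.trans h3
  have h8 : 0 < δ ^ 2 / 2 := by positivity
  refine le_of_mul_le_mul_left ?_ h8
  linarith

/-! ### Laplace's method and elementary limits -/

open MeasureTheory Set in
-- Substitute θ = t/B. Where t² ≤ R, dominated convergence with majorant C e^{-ct²} gives the
-- Gaussian integral. The rest has length at most 2πB and integrand at most C e^{-cR}, so it
-- vanishes by `hBR`.
theorem tendsto_mul_integral_of_gaussian_limit {φ : ℕ → ℝ → ℂ} {B R : ℕ → ℝ} {C c : ℝ}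
    (hC : 0 ≤ C) (hc : 0 < c) (hφ : ∀ᶠ n in atTop, Continuous (φ n)) (hB : Tendsto B atTop atTop)
    (hR : Tendsto R atTop atTop)
    (hBR : Tendsto (fun n => B n * Real.exp (-(c * R n))) atTop (nhds 0))
    (hlim : ∀ t : ℝ, Tendsto (fun n => φ n (t / B n)) atTop
      (nhds ((Real.exp (-(1 / 2) * t ^ 2) : ℝ) : ℂ)))
    (hbd : ∀ᶠ n in atTop, ∀ θ, |θ| ≤ Real.pi →
      ‖φ n θ‖ ≤ C * Real.exp (-(c * min ((B n * θ) ^ 2) (R n)))) :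
    Tendsto (fun n => B n * ∫ θ in (-Real.pi)..Real.pi, φ n θ) atTop
      (nhds (√(2 * Real.pi) : ℝ)) := by
  set I : ℕ → Set ℝ := fun n => Ioc (-Real.pi * B n) (Real.pi * B n)
  set s : ℕ → Set ℝ := fun n => {t | t ^ 2 ≤ R n}
  have hIm : ∀ n, MeasurableSet (I n) := fun n => measurableSet_Ioc
  have hsm : ∀ n, MeasurableSet (s n) := fun n =>
    measurableSet_le (by fun_prop) measurable_const
  have hbd' : ∀ᶠ n in atTop, ∀ t ∈ I n,
      ‖φ n (t / B n)‖ ≤ C * Real.exp (-(c * min (t ^ 2) (R n))) := by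
    filter_upwards [hbd, hB.eventually_gt_atTop 0] with n h1 h2 t ht
    have h3 := h1 (t / B n) (by
      rw [abs_le, le_div_iff₀ h2, div_le_iff₀ h2]; exact ⟨ht.1.le, ht.2⟩)
    rwa [mul_div_cancel₀ _ h2.ne'] at h3
  have hmain : Tendsto (fun n => ∫ t in I n ∩ s n, φ n (t / B n)) atTop
      (nhds (√(2 * Real.pi) : ℝ)) := by
    have hg : ∫ t : ℝ, ((Real.exp (-(1 / 2) * t ^ 2) : ℝ) : ℂ) = (√(2 * Real.pi) : ℝ) := by
      rw [integral_complex_ofReal, integral_gaussian]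
      congr 2; ring
    rw [← hg]
    simp only [← integral_indicator ((hIm _).inter (hsm _))]
    refine tendsto_integral_filter_of_dominated_convergence
      (fun t => C * Real.exp (-c * t ^ 2)) ?_ ?_ ((integrable_exp_neg_mul_sq hc).const_mul C) ?_
    · filter_upwards [hφ] with n hn
      exact ((hn.comp (continuous_id.div_const _)).aestronglyMeasurable).indicator
        ((hIm n).inter (hsm n))
    · filter_upwards [hbd'] with n hn
      refine Eventually.of_forall fun t => ?_
      by_cases ht : t ∈ I n ∩ s n
      · rw [indicator_of_mem ht]
        refine (hn t ht.1).trans (le_of_eq ?_)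
        rw [min_eq_left ht.2, neg_mul]
      · rw [indicator_of_notMem ht, norm_zero]; positivity
    · refine Eventually.of_forall fun t => (hlim t).congr' ?_
      filter_upwards [hB.eventually_gt_atTop |t|, hR.eventually_ge_atTop (t ^ 2)] with n h1 h2
      have hpi := Real.pi_gt_three
      have h3 : |t| < Real.pi * B n := by nlinarith [abs_nonneg t]
      rw [abs_lt] at h3
      rw [indicator_of_mem]
      exact ⟨⟨by linarith [h3.1], h3.2.le⟩, h2⟩
  have hrest : Tendsto (fun n => ∫ t in I n \ s n, φ n (t / B n)) atTop (nhds 0) := by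
    rw [tendsto_zero_iff_norm_tendsto_zero]
    have h0 := hBR.const_mul (2 * Real.pi * C)
    rw [mul_zero] at h0
    refine squeeze_zero' (Eventually.of_forall fun n => norm_nonneg _) ?_ h0
    filter_upwards [hbd', hB.eventually_gt_atTop 0] with n h1 h2
    have hv : volume (I n \ s n) ≤ ENNReal.ofReal (2 * Real.pi * B n) := by
      refine (measure_mono sdiff_subset).trans (le_of_eq ?_)
      rw [Real.volume_Ioc]; congr 1; ring
    refine (norm_setIntegral_le_of_norm_le_const (C := C * Real.exp (-(c * R n)))
      (hv.trans_lt ENNReal.ofReal_lt_top) fun t ht => ?_).trans ?_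
    · refine (h1 t ht.1).trans (le_of_eq ?_)
      rw [min_eq_right (not_le.1 ht.2).le]
    · have h3 : volume.real (I n \ s n) ≤ 2 * Real.pi * B n :=
        ENNReal.toReal_le_of_le_ofReal (by have := Real.pi_pos; positivity) hv
      calc _ ≤ C * Real.exp (-(c * R n)) * (2 * Real.pi * B n) := by gcongr
        _ = _ := by ring
  have hsum := hmain.add hrest
  rw [add_zero] at hsum
  refine hsum.congr' ?_
  filter_upwards [hφ, hB.eventually_gt_atTop 0] with n h1 h2
  have hc' : Continuous fun t => φ n (t / B n) := h1.comp (continuous_id.div_const _)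
  rw [integral_inter_add_sdiff (hsm n) (hc'.integrableOn_Ioc)]
  have h3 := intervalIntegral.integral_comp_div (a := -Real.pi * B n) (b := Real.pi * B n)
    (φ n) h2.ne'
  rw [mul_div_cancel_right₀ _ h2.ne', mul_div_cancel_right₀ _ h2.ne', Complex.real_smul] at h3
  rw [← h3, intervalIntegral.integral_of_le]
  nlinarith [Real.pi_pos]

theorem tendsto_rpow_neg_nhdsGT_zero_atTop {r : ℝ} (hr : 0 < r) :
    Tendsto (fun δ : ℝ => δ ^ (-r)) (nhdsWithin 0 (Set.Ioi 0)) atTop := by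
  refine ((tendsto_rpow_atTop hr).comp tendsto_inv_nhdsGT_zero).congr' ?_
  filter_upwards [self_mem_nhdsWithin] with δ hδ
  rw [Function.comp, Real.inv_rpow (le_of_lt hδ), Real.rpow_neg (le_of_lt hδ)]

theorem tendsto_rpow_nhdsGT_zero {p : ℝ} (hp : 0 < p) :
    Tendsto (fun δ : ℝ => δ ^ p) (nhdsWithin 0 (Set.Ioi 0)) (nhds 0) := by
  have h := (Real.continuousAt_rpow_const 0 p (Or.inr hp.le)).tendsto
  rw [Real.zero_rpow hp.ne'] at h
  exact h.mono_left nhdsWithin_le_nhds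

theorem tendsto_rpow_neg_mul_exp_neg_mul_rpow_neg {r c : ℝ} (p : ℝ) (hr : 0 < r) (hc : 0 < c) :
    Tendsto (fun δ : ℝ => δ ^ (-p) * Real.exp (-(c * δ ^ (-r)))) (nhdsWithin 0 (Set.Ioi 0))
      (nhds 0) := by
  refine ((tendsto_rpow_mul_exp_neg_mul_atTop_nhds_zero (p / r) c hc).comp
    (tendsto_rpow_neg_nhdsGT_zero_atTop hr)).congr' ?_
  filter_upwards [self_mem_nhdsWithin] with δ hδ
  rw [Function.comp, ← Real.rpow_mul (le_of_lt hδ), neg_mul, neg_mul, mul_div_cancel₀ _ hr.ne']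

theorem eventually_tsum_powExp_le {s : ℝ} (hs : 0 < s) :
    ∀ᶠ δ in nhdsWithin (0 : ℝ) (Set.Ioi 0),
      ∑' j, powExp s δ j ≤ (Real.Gamma (s + 1) + 1) * δ ^ (-(s + 1)) := by
  filter_upwards [(tendsto_tsum_powExp_mul_rpow hs).eventually_le_const (lt_add_one _),
    self_mem_nhdsWithin] with δ h hδ
  have hδ : 0 < δ := hδ
  rwa [Real.rpow_neg hδ.le, ← div_eq_mul_inv, le_div_iff₀ (by positivity)]

/-- The integral is complex but its prefactor and the count are real, so taking real parts loses
nothing. The limit √(2π) against the prefactor 1/(2π) leaves 1/√(2π). -/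
theorem isEquivalent_of_tendsto_mul_integral {c A B : ℕ → ℝ} {J : ℕ → ℂ}
    (h : ∀ᶠ n in atTop, (c n : ℂ) = (A n / (2 * Real.pi) : ℝ) * J n)
    (hA : ∀ᶠ n in atTop, 0 < A n) (hB : ∀ᶠ n in atTop, 0 < B n)
    (hJ : Tendsto (fun n => B n * J n) atTop (nhds (√(2 * Real.pi) : ℝ))) :
    c ~[atTop] fun n => A n / (√(2 * Real.pi) * B n) := by
  have hpi : 0 < √(2 * Real.pi) := Real.sqrt_pos.2 (by positivity)
  rw [isEquivalent_iff_tendsto_one]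
  · have h1 := (Complex.continuous_re.tendsto _).comp
      (hJ.const_mul (((√(2 * Real.pi))⁻¹ : ℝ) : ℂ))
    rw [← Complex.ofReal_mul, Complex.ofReal_re, inv_mul_cancel₀ hpi.ne'] at h1
    refine h1.congr' ?_
    filter_upwards [h, hA, hB] with n h2 h3 h4
    have h5 : c n = A n / (2 * Real.pi) * (J n).re := by
      have := congrArg Complex.re h2
      rwa [Complex.ofReal_re, Complex.re_ofReal_mul] at this
    simp only [Function.comp, Complex.re_ofReal_mul, Pi.div_apply]
    rw [h5]
    have h6 : √(2 * Real.pi) * √(2 * Real.pi) = 2 * Real.pi := Real.mul_self_sqrt (by positivity)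
    generalize √(2 * Real.pi) = q at *
    rw [← h6]
    field_simp
  · filter_upwards [hA, hB] with n h3 h4
    positivity

/-! ### Estimates for characteristic functions -/

theorem norm_prod_sub_prod_le_sum {ι : Type*} (s : Finset ι) {z w : ι → ℂ}
    (hz : ∀ i ∈ s, ‖z i‖ ≤ 1) (hw : ∀ i ∈ s, ‖w i‖ ≤ 1) :
    ‖∏ i ∈ s, z i - ∏ i ∈ s, w i‖ ≤ ∑ i ∈ s, ‖z i - w i‖ := by
  classical
  induction s using Finset.induction_on with
  | empty => simp
  | insert i s hi ih =>
    have h1 := ih (fun k hk => hz k (Finset.mem_insert_of_mem hk))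
      fun k hk => hw k (Finset.mem_insert_of_mem hk)
    rw [Finset.prod_insert hi, Finset.prod_insert hi, Finset.sum_insert hi,
      show z i * ∏ k ∈ s, z k - w i * ∏ k ∈ s, w k =
        (z i - w i) * ∏ k ∈ s, z k + w i * (∏ k ∈ s, z k - ∏ k ∈ s, w k) by ring]
    refine (norm_add_le _ _).trans ?_
    rw [norm_mul, norm_mul]
    have h2 : ‖∏ k ∈ s, z k‖ ≤ 1 := by
      rw [norm_prod]
      exact Finset.prod_le_one (fun _ _ => norm_nonneg _)
        fun k hk => hz k (Finset.mem_insert_of_mem hk)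
    have h3 := hw i (Finset.mem_insert_self i s)
    refine add_le_add (mul_le_of_le_one_right (norm_nonneg _) h2) ?_
    exact (mul_le_of_le_one_left (norm_nonneg _) h3).trans h1

theorem norm_pow_sub_pow_le {z w : ℂ} (hz : ‖z‖ ≤ 1) (hw : ‖w‖ ≤ 1) (k : ℕ) :
    ‖z ^ k - w ^ k‖ ≤ k * ‖z - w‖ := by
  simpa using norm_prod_sub_prod_le_sum (Finset.range k) (z := fun _ => z) (w := fun _ => w)
    (fun _ _ => hz) fun _ _ => hw

/-- Valid for every real x: for |x| > 1 the trivial bound 2 + |x| + |x|²/2 is already below 4|x|³.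
-/
theorem norm_exp_mul_I_sub_taylor_le (x : ℝ) :
    ‖Complex.exp (x * Complex.I) - (1 + x * Complex.I - x ^ 2 / 2)‖ ≤ 4 * |x| ^ 3 := by
  have hn : ‖(x : ℂ) * Complex.I‖ = |x| := by simp
  rcases le_or_gt |x| 1 with h | h
  · have h1 := Complex.exp_bound (x := x * Complex.I) (by rwa [hn]) (n := 3) (by norm_num)
    rw [hn] at h1
    have h2 : ∑ m ∈ Finset.range 3, ((x : ℂ) * Complex.I) ^ m / (m.factorial : ℂ) =
        1 + x * Complex.I - x ^ 2 / 2 := by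
      simp [Finset.sum_range_succ, mul_pow, Nat.factorial]
      ring
    rw [h2] at h1
    refine h1.trans ?_
    rw [mul_comm]
    refine mul_le_mul_of_nonneg_right ?_ (by positivity)
    norm_num [Nat.factorial]
  · have h1 : ‖Complex.exp (x * Complex.I)‖ = 1 := Complex.norm_exp_ofReal_mul_I x
    have h2 : ‖(1 + x * Complex.I - x ^ 2 / 2 : ℂ)‖ ≤ 1 + |x| + |x| ^ 2 / 2 := by
      refine (norm_sub_le _ _).trans (add_le_add ((norm_add_le _ _).trans ?_) ?_)
      · rw [hn, norm_one]
      · simp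
    refine (norm_sub_le _ _).trans ?_
    rw [h1]
    have h3 : |x| ≤ |x| ^ 3 := le_self_pow₀ h.le (by norm_num)
    have h4 : |x| ^ 2 ≤ |x| ^ 3 := pow_le_pow_right₀ h.le (by norm_num)
    nlinarith

/-- The characteristic function of a Bernoulli variable with mean `p`. -/
noncomputable def bernoulliChar (p s : ℝ) : ℂ := 1 + p * (Complex.exp (s * Complex.I) - 1)

/-- The squared modulus is exactly 1 - 2p(1-p)(1 - cos s), and 1 + x ≤ e^x. -/
theorem norm_bernoulliChar_le {p : ℝ} (s : ℝ) :
    ‖bernoulliChar p s‖ ≤ Real.exp (-(p * (1 - p) * (1 - Real.cos s))) := by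
  have h1 : ‖bernoulliChar p s‖ ^ 2 = 1 - 2 * (p * (1 - p) * (1 - Real.cos s)) := by
    rw [← Complex.normSq_eq_norm_sq, Complex.normSq_apply, bernoulliChar, Complex.exp_mul_I,
      ← Complex.ofReal_cos, ← Complex.ofReal_sin]
    simp only [Complex.add_re, Complex.one_re, Complex.mul_re, Complex.ofReal_re, Complex.sub_re,
      Complex.ofReal_im, Complex.I_re, Complex.I_im, Complex.add_im, Complex.mul_im, Complex.sub_im,
      Complex.one_im]
    linear_combination p ^ 2 * Real.sin_sq_add_cos_sq s
  refine le_of_sq_le_sq ?_ (Real.exp_pos _).le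
  rw [h1, ← Real.exp_nat_mul]
  refine le_trans (le_of_eq ?_) (Real.add_one_le_exp _)
  push_cast; ring

/-- The centred function is (1-p) e^{-ips} + p e^{i(1-p)s}: the linear Taylor terms cancel and the
quadratic ones give -p(1-p)s²/2. The cubic errors carry (1-p)p³ + p(1-p)³ = v(1-2v) with v = p(1-p),
so the bound is proportional to the variance. -/
theorem norm_centered_bernoulliChar_sub_le {p : ℝ} (h0 : 0 ≤ p) (h1 : p ≤ 1) (s : ℝ) :
    ‖Complex.exp (-(p * s * Complex.I)) * bernoulliChar p s -
      (Real.exp (-(p * (1 - p) * s ^ 2 / 2)) : ℝ)‖ ≤ 5 * (p * (1 - p) * |s| ^ 3) := by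
  set v := p * (1 - p) with hv
  have hq : 0 ≤ 1 - p := by linarith
  have hv0 : 0 ≤ v := mul_nonneg h0 hq
  have hv1 : v ≤ 1 / 4 := by nlinarith [sq_nonneg (p - 1 / 2)]
  set T : ℝ → ℂ := fun x => Complex.exp (x * Complex.I) - (1 + x * Complex.I - x ^ 2 / 2) with hT
  have hsplit : Complex.exp (-(p * s * Complex.I)) * bernoulliChar p s -
      (Real.exp (-(v * s ^ 2 / 2)) : ℝ) =
      ((1 - p : ℝ) * T (-(p * s)) + p * T ((1 - p) * s)) +
        ((1 - v * s ^ 2 / 2 - Real.exp (-(v * s ^ 2 / 2)) : ℝ) : ℂ) := by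
    have e1 : Complex.exp (((1 - p) * s : ℝ) * Complex.I) =
        Complex.exp (-(p * s * Complex.I)) * Complex.exp (s * Complex.I) := by
      rw [← Complex.exp_add]; congr 1; push_cast; ring
    have e2 : Complex.exp ((-(p * s) : ℝ) * Complex.I) = Complex.exp (-(p * s * Complex.I)) := by
      congr 1; push_cast; ring
    simp only [hT, bernoulliChar, hv]
    rw [e1, e2]
    push_cast
    ring
  rw [hsplit]
  have hT1 : ‖((1 - p : ℝ) : ℂ) * T (-(p * s))‖ ≤ (1 - p) * (4 * (p ^ 3 * |s| ^ 3)) := by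
    rw [norm_mul, Complex.norm_real, Real.norm_of_nonneg hq]
    refine mul_le_mul_of_nonneg_left ((norm_exp_mul_I_sub_taylor_le _).trans (le_of_eq ?_)) hq
    rw [abs_neg, abs_mul, abs_of_nonneg h0, mul_pow]
  have hT2 : ‖(p : ℂ) * T ((1 - p) * s)‖ ≤ p * (4 * ((1 - p) ^ 3 * |s| ^ 3)) := by
    rw [norm_mul, Complex.norm_real, Real.norm_of_nonneg h0]
    refine mul_le_mul_of_nonneg_left ((norm_exp_mul_I_sub_taylor_le _).trans (le_of_eq ?_)) h0
    rw [abs_mul, abs_of_nonneg hq, mul_pow]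
  have hE : ‖((1 - v * s ^ 2 / 2 - Real.exp (-(v * s ^ 2 / 2)) : ℝ) : ℂ)‖ ≤ v * |s| ^ 3 := by
    rw [Complex.norm_real, Real.norm_eq_abs]
    set u := v * s ^ 2 / 2 with hu
    have hu0 : 0 ≤ u := by positivity
    have e1 : 1 - u ≤ Real.exp (-u) := by linarith [Real.add_one_le_exp (-u)]
    have e2 : Real.exp (-u) ≤ 1 := Real.exp_le_one_iff.2 (by linarith)
    have e3 : Real.exp (-u) ≤ 1 - u + u ^ 2 := by
      have e4 : Real.exp (-u) * (1 + u) ≤ 1 := by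
        calc _ ≤ Real.exp (-u) * Real.exp u := by
              gcongr; linarith [Real.add_one_le_exp u]
          _ = 1 := by rw [← Real.exp_add]; simp
      have e5 : 1 ≤ (1 - u + u ^ 2) * (1 + u) := by nlinarith [pow_nonneg hu0 3]
      exact le_of_mul_le_mul_right (e4.trans e5) (by linarith)
    rw [abs_sub_comm, abs_of_nonneg (by linarith)]
    rw [← sq_abs s] at hu
    -- The error e^{-u} - (1 - u) is at most both u² and u; the first beats v|s|³ for |s| ≤ 1, the
    -- second for |s| > 1.
    rcases le_or_gt |s| 1 with h | h
    · have : u ^ 2 ≤ v * |s| ^ 3 := by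
        have h3 : |s| ^ 4 ≤ |s| ^ 3 := pow_le_pow_of_le_one (abs_nonneg s) h (by norm_num)
        calc u ^ 2 = v * (v / 4) * |s| ^ 4 := by rw [hu]; ring
          _ ≤ v * 1 * |s| ^ 3 := by gcongr; linarith
          _ = _ := by ring
      linarith
    · have h4 : |s| ^ 2 ≤ |s| ^ 3 := pow_le_pow_right₀ h.le (by norm_num)
      have : u ≤ v * |s| ^ 3 := by
        rw [hu]
        nlinarith [mul_le_mul_of_nonneg_left h4 hv0, mul_nonneg hv0 (sq_nonneg |s|)]
      linarith
  refine (norm_add_le _ _).trans ((add_le_add ((norm_add_le _ _).trans (add_le_add hT1 hT2)) hE).trans ?_)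
  have h3 : (1 - p) * (4 * (p ^ 3 * |s| ^ 3)) + p * (4 * ((1 - p) ^ 3 * |s| ^ 3)) =
      4 * (v * |s| ^ 3) * (1 - 2 * v) := by rw [hv]; ring
  rw [h3]
  have : 0 ≤ v * |s| ^ 3 := by positivity
  nlinarith

/-! ### The saddle point of selections: existence, uniqueness, location -/

theorem selectionMean_term_nonneg (a : ℕ → ℕ) (j : ℕ) (σ : ℝ) :
    0 ≤ (j : ℝ) * (a j : ℝ) * Real.exp (-(j * σ)) / (1 + Real.exp (-(j * σ))) := by positivity

theorem strictAnti_selectionMean {a : ℕ → ℕ} (ha : ∀ j, 1 ≤ j → 1 ≤ a j) {n : ℕ} (hn : 1 ≤ n) :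
    StrictAnti (selectionMean a n) := by
  intro s t hst
  unfold selectionMean
  refine Finset.sum_lt_sum_of_nonempty ⟨1, by simpa using hn⟩ fun j hj => ?_
  have hj1 := (Finset.mem_Icc.1 hj).1
  have hj0 : (0 : ℝ) < j := by exact_mod_cast hj1
  have ha0 : (0 : ℝ) < a j := by exact_mod_cast ha j hj1
  have he : Real.exp (-(j * t)) < Real.exp (-(j * s)) := by
    rw [Real.exp_lt_exp]; nlinarith
  have h1 := Real.exp_pos (-(j * t))
  rw [div_lt_div_iff₀ (by positivity) (by positivity)]
  have : 0 < (j : ℝ) * a j := by positivity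
  nlinarith

theorem continuous_selectionMean (a : ℕ → ℕ) (n : ℕ) : Continuous (selectionMean a n) := by
  unfold selectionMean
  refine continuous_finsetSum _ fun j _ => ?_
  refine Continuous.div (by fun_prop) (by fun_prop) fun σ => ?_
  positivity

theorem tendsto_selectionMean_atTop (a : ℕ → ℕ) (n : ℕ) :
    Tendsto (selectionMean a n) atTop (nhds 0) := by
  have h0 : Tendsto (fun σ : ℝ => ∑ j ∈ Finset.Icc 1 n, (j : ℝ) * a j * Real.exp (-(j * σ))) atTop
      (nhds (∑ j ∈ Finset.Icc 1 n, (j : ℝ) * a j * 0)) := by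
    refine tendsto_finsetSum _ fun j hj => Tendsto.const_mul _ ?_
    have hj0 : (0 : ℝ) < j := by exact_mod_cast (Finset.mem_Icc.1 hj).1
    exact Real.tendsto_exp_neg_atTop_nhds_zero.comp (tendsto_id.const_mul_atTop hj0)
  simp only [mul_zero, Finset.sum_const_zero] at h0
  refine squeeze_zero (fun σ => Finset.sum_nonneg fun j _ => selectionMean_term_nonneg a j σ)
    (fun σ => Finset.sum_le_sum fun j _ => ?_) h0
  refine div_le_self (by positivity) ?_
  linarith [Real.exp_pos (-(j * σ))]

/-- At σ = 0 the mean is at least ∑ j/2 = n(n+1)/4, which exceeds n once n ≥ 4. -/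
theorem lt_selectionMean_zero {a : ℕ → ℕ} (ha : ∀ j, 1 ≤ j → 1 ≤ a j) {n : ℕ} (hn : 4 ≤ n) :
    (n : ℝ) < selectionMean a n 0 := by
  have h1 : ∑ j ∈ Finset.Icc 1 n, (j : ℝ) / 2 ≤ selectionMean a n 0 := by
    refine Finset.sum_le_sum fun j hj => ?_
    have ha1 : (1 : ℝ) ≤ a j := by exact_mod_cast ha j (Finset.mem_Icc.1 hj).1
    have hj0 : (0 : ℝ) ≤ j := j.cast_nonneg
    simp only [mul_zero, neg_zero, Real.exp_zero, mul_one]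
    rw [one_add_one_eq_two]
    gcongr
    nlinarith
  have h2 : ∀ m : ℕ, ∑ j ∈ Finset.Icc 1 m, (j : ℝ) / 2 = m * (m + 1) / 4 := by
    intro m
    induction m with
    | zero => simp
    | succ m ih =>
      rw [Finset.sum_Icc_succ_top (by omega), ih]
      push_cast; ring
  rw [h2] at h1
  have : (4 : ℝ) ≤ n := by exact_mod_cast hn
  nlinarith

theorem exists_unique_selectionMean_eq {a : ℕ → ℕ} (ha : ∀ j, 1 ≤ j → 1 ≤ a j) {n : ℕ}
    (hn : 4 ≤ n) :
    ∃ s : ℝ, 0 < s ∧ selectionMean a n s = n ∧ ∀ t : ℝ, selectionMean a n t = n → t = s := by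
  have hanti := strictAnti_selectionMean ha (by omega : 1 ≤ n)
  have h0 := lt_selectionMean_zero ha hn
  have hn0 : (0 : ℝ) < n := by exact_mod_cast (by omega : 0 < n)
  obtain ⟨b, hb⟩ := ((tendsto_selectionMean_atTop a n).eventually_lt_const hn0).exists
  obtain ⟨s, hs⟩ := mem_range_of_exists_le_of_exists_ge (continuous_selectionMean a n)
    ⟨b, hb.le⟩ ⟨0, h0.le⟩
  refine ⟨s, ?_, hs, fun t ht => hanti.injective (ht.trans hs.symm)⟩
  rw [← hs] at h0
  exact hanti.lt_iff_gt.1 h0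

theorem pow_mul_exp_neg_mul {y : ℝ} (hy : 0 < y) (σ : ℝ) (j : ℕ) :
    y ^ j * Real.exp (-(j * σ)) = Real.exp (-(j * (σ - Real.log y))) := by
  rw [← Real.exp_log (pow_pos hy j), Real.log_pow, ← Real.exp_add]
  congr 1; ring

theorem powExp_sub_one_mul (r δ : ℝ) (j : ℕ) : j * powExp (r - 1) δ j = powExp r δ j := by
  have := powExp_add_one (r - 1) δ j
  rw [sub_add_cancel] at this
  rw [this, mul_comm]

theorem powExp_sub_one_mul_sq (r δ : ℝ) (j : ℕ) :
    (j : ℝ) ^ 2 * powExp (r - 1) δ j = powExp (r + 1) δ j := by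
  rw [powExp_add_one r, ← powExp_sub_one_mul r]; ring

theorem powExp_sub_one_mul_cube (r δ : ℝ) (j : ℕ) :
    (j : ℝ) ^ 3 * powExp (r - 1) δ j = powExp (r + 2) δ j := by
  rw [show r + 2 = r + 1 + 1 by ring, powExp_add_one (r + 1), ← powExp_sub_one_mul_sq r δ j]; ring

theorem mul_powExp_le_of_le {a : ℕ → ℕ} {r y D : ℝ} (hy : 0 < y)
    (h : ∀ j : ℕ, 1 ≤ j → D * ((j : ℝ) ^ (r - 1) * y ^ j) ≤ a j) (σ : ℝ) (j : ℕ) :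
    D * powExp (r - 1) (σ - Real.log y) j ≤ a j * Real.exp (-(j * σ)) := by
  rcases Nat.eq_zero_or_pos j with rfl | hj
  · simp [powExp]
  · rw [powExp_of_ne_zero _ _ hj.ne', ← pow_mul_exp_neg_mul hy, ← mul_assoc, ← mul_assoc,
      mul_assoc D]
    exact mul_le_mul_of_nonneg_right (h j hj) (Real.exp_pos _).le

theorem le_mul_powExp_of_le {a : ℕ → ℕ} {r y D : ℝ} (hy : 0 < y)
    (h : ∀ j : ℕ, 1 ≤ j → (a j : ℝ) ≤ D * ((j : ℝ) ^ (r - 1) * y ^ j)) (σ : ℝ) {j : ℕ}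
    (hj : 1 ≤ j) :
    a j * Real.exp (-(j * σ)) ≤ D * powExp (r - 1) (σ - Real.log y) j := by
  rw [powExp_of_ne_zero _ _ (by omega), ← pow_mul_exp_neg_mul hy, ← mul_assoc, ← mul_assoc,
    mul_assoc D]
  exact mul_le_mul_of_nonneg_right (h j hj) (Real.exp_pos _).le

/-- If σ were below log y + A/n, monotonicity would make n exceed the mean at log y + A/n. That mean
is at least of order (n/A)^{r+1}, a contradiction for large n. This shows that truncating at n
leaves the relevant range j ≈ 1/δ intact. -/
theorem tendsto_mul_saddle_sub_log {a : ℕ → ℕ} {r y D : ℝ} (hr : 0 < r) (hy : 1 ≤ y) (hD : 0 < D)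
    (ha : ∀ j, 1 ≤ j → 1 ≤ a j)
    (h : ∀ j : ℕ, 1 ≤ j → D * ((j : ℝ) ^ (r - 1) * y ^ j) ≤ a j) {σ : ℕ → ℝ}
    (hσ : ∀ᶠ n : ℕ in atTop, selectionMean a n (σ n) = n) :
    Tendsto (fun n : ℕ => n * (σ n - Real.log y)) atTop atTop := by
  rw [tendsto_atTop]
  intro A₀
  -- The value 12 is what the second-moment lower bound requires of n · (A/n).
  set A := max A₀ 12 with hA
  have hA12 : 12 ≤ A := le_max_right _ _
  obtain ⟨c, hc, hcl⟩ := exists_le_sum_powExp_add_one (r - 1)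
  have hlarge : ∀ᶠ n : ℕ in atTop, (n : ℝ) < D / 2 * (c * (A / n) ^ (-(r + 1))) := by
    have h1 : Tendsto (fun n : ℕ => (n : ℝ) ^ r) atTop atTop :=
      (tendsto_rpow_atTop hr).comp tendsto_natCast_atTop_atTop
    have hK : 0 < D / 2 * c * A ^ (-(r + 1)) := by positivity
    filter_upwards [h1.eventually_gt_atTop (1 / (D / 2 * c * A ^ (-(r + 1)))),
      eventually_gt_atTop 0] with n h2 h3
    have h3 : (0 : ℝ) < n := by exact_mod_cast h3
    rw [div_lt_iff₀ hK] at h2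
    rw [Real.div_rpow (by positivity) h3.le, Real.rpow_neg h3.le, div_inv_eq_mul,
      Real.rpow_add_one h3.ne']
    nlinarith
  filter_upwards [hσ, hlarge, eventually_ge_atTop ⌈A⌉₊, eventually_gt_atTop 0] with n h1 h2 h3 hn0
  by_contra hcon
  have hn : (0 : ℝ) < n := by exact_mod_cast hn0
  have hnA : A ≤ n := Nat.ceil_le.1 h3
  have hlt : σ n < Real.log y + A / n := by
    have h4 : n * (σ n - Real.log y) < A := (not_le.1 hcon).trans_le (le_max_left _ _)
    have : σ n - Real.log y < A / n := by rwa [lt_div_iff₀ hn, mul_comm]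
    linarith
  have hM := strictAnti_selectionMean ha hn0 hlt
  rw [h1] at hM
  -- The factor 1/2 absorbs the denominators 1 + e^{-jσ} ≤ 2, valid because log y ≥ 0.
  have hlow : D / 2 * ∑ j ∈ Finset.Icc 1 n, powExp r (A / n) j ≤
      selectionMean a n (Real.log y + A / n) := by
    rw [Finset.mul_sum]
    refine Finset.sum_le_sum fun j _ => ?_
    have h4 := mul_powExp_le_of_le (by linarith) h (Real.log y + A / n) j
    rw [add_sub_cancel_left] at h4
    have hE : Real.exp (-(j * (Real.log y + A / n))) ≤ 1 := by
      refine Real.exp_le_one_iff.2 (neg_nonpos.2 ?_)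
      have := Real.log_nonneg hy
      positivity
    have hE0 := Real.exp_pos (-(j * (Real.log y + A / n)))
    rw [← powExp_sub_one_mul, le_div_iff₀ (by positivity)]
    have hp : 0 ≤ D * (j * powExp (r - 1) (A / n) j) :=
      mul_nonneg hD.le (mul_nonneg j.cast_nonneg (powExp_nonneg _ _ _))
    have h5 := mul_le_mul_of_nonneg_left h4 (j.cast_nonneg : (0 : ℝ) ≤ j)
    nlinarith
  have h6 := hcl (A / n) (by positivity) (by rwa [div_le_one hn]) n
    (by rw [mul_div_cancel₀ _ hn.ne']; exact hA12)
  rw [sub_add_cancel, show r - 1 + 2 = r + 1 by ring] at h6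
  have h7 : D / 2 * (c * (A / n) ^ (-(r + 1))) ≤
      D / 2 * ∑ j ∈ Finset.Icc 1 n, powExp r (A / n) j := by gcongr
  linarith

theorem selectionMean_le {a : ℕ → ℕ} {r y D : ℝ} (hy : 0 < y)
    (h : ∀ j : ℕ, 1 ≤ j → (a j : ℝ) ≤ D * ((j : ℝ) ^ (r - 1) * y ^ j)) (n : ℕ) (σ : ℝ) :
    selectionMean a n σ ≤ D * ∑ j ∈ Finset.Icc 1 n, powExp r (σ - Real.log y) j := by
  rw [Finset.mul_sum]
  refine Finset.sum_le_sum fun j hj => ?_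
  have h4 := le_mul_powExp_of_le hy h σ (Finset.mem_Icc.1 hj).1
  refine (div_le_self (by positivity) (by linarith [Real.exp_pos (-(j * σ))])).trans ?_
  rw [← powExp_sub_one_mul]
  have h5 := mul_le_mul_of_nonneg_left h4 (j.cast_nonneg : (0 : ℝ) ≤ j)
  linarith

/-- If σ - log y stayed at least ε, the mean would be bounded by the fixed number D ∑ j^r e^{-jε},
so it could not equal a large n. -/
theorem tendsto_saddle_sub_log {a : ℕ → ℕ} {r y D : ℝ} (hy : 0 < y) (hD : 0 < D)
    (h : ∀ j : ℕ, 1 ≤ j → (a j : ℝ) ≤ D * ((j : ℝ) ^ (r - 1) * y ^ j)) {σ : ℕ → ℝ}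
    (hσ : ∀ᶠ n : ℕ in atTop, selectionMean a n (σ n) = n)
    (hσ' : Tendsto (fun n : ℕ => n * (σ n - Real.log y)) atTop atTop) :
    Tendsto (fun n => σ n - Real.log y) atTop (nhdsWithin 0 (Set.Ioi 0)) := by
  have hpos : ∀ᶠ n : ℕ in atTop, 0 < σ n - Real.log y := by
    filter_upwards [hσ'.eventually_gt_atTop 0] with n hn
    exact pos_of_mul_pos_right hn n.cast_nonneg
  refine tendsto_nhdsWithin_iff.2 ⟨?_, hpos⟩
  refine tendsto_order.2 ⟨fun x hx => hpos.mono fun n hn => hx.trans hn, fun ε hε => ?_⟩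
  filter_upwards [hσ, tendsto_natCast_atTop_atTop.eventually_gt_atTop (D * ∑' j, powExp r ε j)]
    with n h1 h2
  by_contra hcon
  have h3 := selectionMean_le hy h n (σ n)
  rw [h1] at h3
  have h4 : ∑ j ∈ Finset.Icc 1 n, powExp r (σ n - Real.log y) j ≤ ∑' j, powExp r ε j :=
    (Finset.sum_le_sum fun j _ => powExp_anti (not_lt.1 hcon) j).trans
      (sum_Icc_powExp_le_tsum r hε n)
  have := mul_le_mul_of_nonneg_left h4 hD.le
  linarith

/-! ### Selections: central limit theorem and asymptotics -/

/-- The success probability of a Bernoulli variable with odds `e^{-jσ}`. -/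
noncomputable def tiltedProb (σ : ℝ) (j : ℕ) : ℝ := Real.exp (-(j * σ)) / (1 + Real.exp (-(j * σ)))

theorem tiltedProb_nonneg (σ : ℝ) (j : ℕ) : 0 ≤ tiltedProb σ j := by
  unfold tiltedProb; positivity

theorem tiltedProb_le_one (σ : ℝ) (j : ℕ) : tiltedProb σ j ≤ 1 := by
  unfold tiltedProb
  rw [div_le_one (by positivity)]
  linarith

theorem tiltedProb_mul_one_sub (σ : ℝ) (j : ℕ) :
    tiltedProb σ j * (1 - tiltedProb σ j) =
      Real.exp (-(j * σ)) / (1 + Real.exp (-(j * σ))) ^ 2 := by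
  unfold tiltedProb
  have : 1 + Real.exp (-(j * σ)) ≠ 0 := by positivity
  field_simp
  ring

theorem tiltedProb_mul_one_sub_nonneg (σ : ℝ) (j : ℕ) :
    0 ≤ tiltedProb σ j * (1 - tiltedProb σ j) :=
  mul_nonneg (tiltedProb_nonneg σ j) (by linarith [tiltedProb_le_one σ j])

theorem tiltedProb_mul_one_sub_le (σ : ℝ) (j : ℕ) :
    tiltedProb σ j * (1 - tiltedProb σ j) ≤ Real.exp (-(j * σ)) := by
  rw [tiltedProb_mul_one_sub]
  refine div_le_self (Real.exp_pos _).le ?_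
  nlinarith [Real.exp_pos (-(j * σ))]

theorem le_tiltedProb_mul_one_sub {σ : ℝ} (hσ : 0 ≤ σ) (j : ℕ) :
    Real.exp (-(j * σ)) / 4 ≤ tiltedProb σ j * (1 - tiltedProb σ j) := by
  rw [tiltedProb_mul_one_sub]
  have h : Real.exp (-(j * σ)) ≤ 1 := Real.exp_le_one_iff.2 (neg_nonpos.2 (by positivity))
  have h0 := Real.exp_pos (-(j * σ))
  gcongr
  nlinarith

theorem selectionMean_eq_sum (a : ℕ → ℕ) (n : ℕ) (σ : ℝ) :
    selectionMean a n σ = ∑ j ∈ Finset.Icc 1 n, (j : ℝ) * a j * tiltedProb σ j :=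
  Finset.sum_congr rfl fun j _ => by rw [tiltedProb, mul_div_assoc]

theorem selectionVariance_eq_sum (a : ℕ → ℕ) (n : ℕ) (σ : ℝ) :
    selectionVariance a n σ = ∑ j ∈ Finset.Icc 1 n,
      (j : ℝ) ^ 2 * (a j * (tiltedProb σ j * (1 - tiltedProb σ j))) :=
  Finset.sum_congr rfl fun j _ => by rw [tiltedProb_mul_one_sub]; ring

/-- The characteristic function, centred at `n`, of the size of a random selection. -/
noncomputable def selectionChar (a : ℕ → ℕ) (n : ℕ) (σ θ : ℝ) : ℂ :=
  (∏ j ∈ Finset.Icc 1 n, bernoulliChar (tiltedProb σ j) (j * θ) ^ a j) *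
    Complex.exp (-(n * θ * Complex.I))

theorem selectionCount_eq_integral_selectionChar (a : ℕ → ℕ) {n : ℕ} (hn : 1 ≤ n) (σ : ℝ) :
    (selectionCount a n : ℂ) =
      (Real.exp (n * σ) * ∏ j ∈ Finset.Icc 1 n, (1 + Real.exp (-(j * σ))) ^ a j) / (2 * Real.pi) *
        ∫ θ in (-Real.pi)..Real.pi, selectionChar a n σ θ := by
  rw [selectionCount_eq_integral a hn σ, mul_div_right_comm, mul_assoc]
  congr 1
  rw [← intervalIntegral.integral_const_mul]
  congr 1
  funext θ
  rw [selectionChar, ← mul_assoc]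
  congr 1
  push_cast
  rw [← Finset.prod_mul_distrib]
  refine Finset.prod_congr rfl fun j _ => ?_
  rw [← mul_pow]
  congr 1
  have h1 : Complex.exp (-σ + θ * Complex.I) ^ j =
      Complex.exp (-(j * σ)) * Complex.exp ((j * θ : ℝ) * Complex.I) := by
    rw [← Complex.exp_nat_mul, ← Complex.exp_add]
    congr 1; push_cast; ring
  have h2 : (1 : ℂ) + Complex.exp (-(j * σ)) ≠ 0 := by
    have : (1 : ℝ) + Real.exp (-(j * σ)) ≠ 0 := by positivity
    exact_mod_cast this
  rw [h1, bernoulliChar, tiltedProb]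
  push_cast
  field_simp
  ring

theorem norm_selectionChar_le (a : ℕ → ℕ) (n : ℕ) (σ θ : ℝ) :
    ‖selectionChar a n σ θ‖ ≤ Real.exp (-∑ j ∈ Finset.Icc 1 n,
      a j * (tiltedProb σ j * (1 - tiltedProb σ j)) * (1 - Real.cos (j * θ))) := by
  have h1 : ‖Complex.exp (-(n * θ * Complex.I))‖ = 1 := by
    rw [Complex.norm_exp]; simp
  rw [selectionChar, norm_mul, h1, mul_one, norm_prod, ← Finset.sum_neg_distrib, Real.exp_sum]
  refine Finset.prod_le_prod (fun _ _ => norm_nonneg _) fun j _ => ?_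
  rw [norm_pow]
  refine (pow_le_pow_left₀ (norm_nonneg _) (norm_bernoulliChar_le _) _).trans (le_of_eq ?_)
  rw [← Real.exp_nat_mul]
  congr 1; ring

/-- The saddle point equation splits e^{-inθ} into the individual centrings of the Bernoulli
factors. All factors then have modulus at most 1, so they may be replaced one by one by Gaussians
and the cubic errors add up. -/
theorem norm_selectionChar_sub_le {a : ℕ → ℕ} {n : ℕ} {σ : ℝ} (h : selectionMean a n σ = n)
    (θ : ℝ) :
    ‖selectionChar a n σ θ - (Real.exp (-(selectionVariance a n σ * θ ^ 2 / 2)) : ℝ)‖ ≤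
      5 * |θ| ^ 3 * ∑ j ∈ Finset.Icc 1 n,
        (j : ℝ) ^ 3 * (a j * (tiltedProb σ j * (1 - tiltedProb σ j))) := by
  have h1 : selectionChar a n σ θ = ∏ j ∈ Finset.Icc 1 n,
      (Complex.exp (-(tiltedProb σ j * (j * θ : ℝ) * Complex.I)) *
        bernoulliChar (tiltedProb σ j) (j * θ)) ^ a j := by
    simp only [mul_pow]
    rw [Finset.prod_mul_distrib, selectionChar, mul_comm]
    congr 1
    simp only [← Complex.exp_nat_mul]
    rw [← Complex.exp_sum]
    congr 1
    have : (n : ℂ) = ((∑ j ∈ Finset.Icc 1 n, (j : ℝ) * a j * tiltedProb σ j : ℝ) : ℂ) := by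
      rw [← selectionMean_eq_sum, h]; simp
    rw [this]
    push_cast
    rw [Finset.sum_mul, Finset.sum_mul, ← Finset.sum_neg_distrib]
    refine Finset.sum_congr rfl fun j _ => ?_
    ring
  have h2 : ((Real.exp (-(selectionVariance a n σ * θ ^ 2 / 2)) : ℝ) : ℂ) =
      ∏ j ∈ Finset.Icc 1 n, ((Real.exp (-(tiltedProb σ j * (1 - tiltedProb σ j) *
        (j * θ) ^ 2 / 2)) : ℝ) : ℂ) ^ a j := by
    rw [selectionVariance_eq_sum]
    norm_cast
    simp only [← Real.exp_nat_mul]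
    rw [← Real.exp_sum, Finset.sum_mul, Finset.sum_div, ← Finset.sum_neg_distrib]
    congr 1
    refine Finset.sum_congr rfl fun j _ => ?_
    push_cast
    ring
  have hz : ∀ j : ℕ, ‖Complex.exp (-(tiltedProb σ j * (j * θ : ℝ) * Complex.I)) *
      bernoulliChar (tiltedProb σ j) (j * θ)‖ ≤ 1 := by
    intro j
    have h3 : ‖Complex.exp (-(tiltedProb σ j * (j * θ : ℝ) * Complex.I))‖ = 1 := by
      rw [Complex.norm_exp]; simp
    rw [norm_mul, h3, one_mul]
    refine (norm_bernoulliChar_le _).trans (Real.exp_le_one_iff.2 (neg_nonpos.2 ?_))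
    exact mul_nonneg (tiltedProb_mul_one_sub_nonneg σ j) (by linarith [Real.cos_le_one (j * θ)])
  have hw : ∀ j : ℕ, ‖((Real.exp (-(tiltedProb σ j * (1 - tiltedProb σ j) *
        (j * θ) ^ 2 / 2)) : ℝ) : ℂ)‖ ≤ 1 := by
    intro j
    rw [Complex.norm_real, Real.norm_of_nonneg (Real.exp_pos _).le]
    refine Real.exp_le_one_iff.2 (neg_nonpos.2 ?_)
    have := tiltedProb_mul_one_sub_nonneg σ j
    positivity
  rw [h1, h2, Finset.mul_sum]
  refine (norm_prod_sub_prod_le_sum _ (fun j _ => ?_) fun j _ => ?_).trans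
    (Finset.sum_le_sum fun j _ => ?_)
  · rw [norm_pow]; exact pow_le_one₀ (norm_nonneg _) (hz j)
  · rw [norm_pow]; exact pow_le_one₀ (norm_nonneg _) (hw j)
  · refine (norm_pow_sub_pow_le (hz j) (hw j) _).trans ?_
    have h4 := norm_centered_bernoulliChar_sub_le (tiltedProb_nonneg σ j) (tiltedProb_le_one σ j)
      (j * θ)
    refine (mul_le_mul_of_nonneg_left h4 (a j).cast_nonneg).trans (le_of_eq ?_)
    rw [abs_mul, Nat.abs_cast]
    ring

theorem selectionCount_isEquivalent {a : ℕ → ℕ} {r y D₁ D₂ : ℝ} (hr : 0 < r) (hy : 1 ≤ y)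
    (hD₁ : 0 < D₁) (hD₂ : 0 < D₂) (ha : ∀ j, 1 ≤ j → 1 ≤ a j)
    (h₁ : ∀ j : ℕ, 1 ≤ j → D₁ * ((j : ℝ) ^ (r - 1) * y ^ j) ≤ a j)
    (h₂ : ∀ j : ℕ, 1 ≤ j → (a j : ℝ) ≤ D₂ * ((j : ℝ) ^ (r - 1) * y ^ j)) {σ : ℕ → ℝ}
    (hσ : ∀ᶠ n : ℕ in atTop, selectionMean a n (σ n) = n) :
    (fun n : ℕ => (selectionCount a n : ℝ)) ~[atTop]
      fun n : ℕ => Real.exp (n * σ n) / √(2 * Real.pi * selectionVariance a n (σ n)) *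
        ∏ j ∈ Finset.Icc 1 n, (1 + Real.exp (-(j * σ n))) ^ a j := by
  have hy0 : 0 < y := by linarith
  set δ : ℕ → ℝ := fun n => σ n - Real.log y with hδdef
  have hnδ : Tendsto (fun n : ℕ => n * δ n) atTop atTop :=
    tendsto_mul_saddle_sub_log hr hy hD₁ ha h₁ hσ
  have hδ : Tendsto δ atTop (nhdsWithin 0 (Set.Ioi 0)) :=
    tendsto_saddle_sub_log hy0 hD₂ h₂ hσ hnδ
  have hδpos : ∀ᶠ n in atTop, 0 < δ n := hδ.eventually self_mem_nhdsWithin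
  have hδone : ∀ᶠ n in atTop, δ n ≤ 1 :=
    (hδ.mono_right nhdsWithin_le_nhds).eventually_le_const one_pos
  -- The total variance weight of size j lies between D₁/4 and D₂ times j^{r-1} e^{-jδ}, which
  -- reduces every moment to a sum of `powExp`.
  set v : ℕ → ℕ → ℝ := fun n j => a j * (tiltedProb (σ n) j * (1 - tiltedProb (σ n) j)) with hv
  have hvup : ∀ n j : ℕ, 1 ≤ j → v n j ≤ D₂ * powExp (r - 1) (δ n) j := fun n j hj =>
    (mul_le_mul_of_nonneg_left (tiltedProb_mul_one_sub_le _ j) (a j).cast_nonneg).trans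
      (le_mul_powExp_of_le hy0 h₂ (σ n) hj)
  have hvlow : ∀ᶠ n in atTop, ∀ j : ℕ, D₁ / 4 * powExp (r - 1) (δ n) j ≤ v n j := by
    filter_upwards [hδpos] with n hn j
    have hσ0 : 0 ≤ σ n := by
      have := Real.log_nonneg hy
      have : 0 < σ n - Real.log y := hn
      linarith
    have h3 := mul_powExp_le_of_le hy0 h₁ (σ n) j
    have h4 := mul_le_mul_of_nonneg_left (le_tiltedProb_mul_one_sub hσ0 j)
      ((a j).cast_nonneg : (0 : ℝ) ≤ a j)
    simp only [hv]
    linarith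
  -- two-sided bounds for the variance, and a bound for the third moments
  obtain ⟨c₀, hc₀, hlowvar⟩ := exists_le_sum_powExp_add_one r
  obtain ⟨c₁, hc₁, hcos⟩ := exists_le_sum_powExp_mul_one_sub_cos r
  set V : ℕ → ℝ := fun n => selectionVariance a n (σ n) with hV
  have hVsum : ∀ n, V n = ∑ j ∈ Finset.Icc 1 n, (j : ℝ) ^ 2 * v n j := fun n =>
    selectionVariance_eq_sum a n (σ n)
  set b := D₁ / 4 * c₀ with hb
  have hb0 : 0 < b := by positivity
  -- The maximum with 1 allows C to be pulled out of both arms of min((Bθ)², δ^{-r}) below.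
  set C := max 1 (D₂ * (Real.Gamma (r + 2) + 1)) with hC
  have hC0 : 0 < C := lt_max_of_lt_left one_pos
  have hVlow : ∀ᶠ n in atTop, b * δ n ^ (-(r + 2)) ≤ V n := by
    filter_upwards [hvlow, hδpos, hδone, hnδ.eventually_ge_atTop 12] with n h3 h4 h5 h6
    rw [hVsum]
    have h7 := hlowvar (δ n) h4 h5 n h6
    calc b * δ n ^ (-(r + 2)) = D₁ / 4 * (c₀ * δ n ^ (-(r + 2))) := by rw [hb]; ring
      _ ≤ D₁ / 4 * ∑ j ∈ Finset.Icc 1 n, powExp (r + 1) (δ n) j := by gcongr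
      _ ≤ _ := by
        rw [Finset.mul_sum]
        refine Finset.sum_le_sum fun j _ => ?_
        rw [← powExp_sub_one_mul_sq, mul_left_comm]
        exact mul_le_mul_of_nonneg_left (h3 j) (by positivity)
  have hVup : ∀ᶠ n in atTop, V n ≤ C * δ n ^ (-(r + 2)) := by
    filter_upwards [hδ.eventually (eventually_tsum_powExp_le (by linarith : 0 < r + 1)), hδpos]
      with n h3 h4
    rw [show r + 1 + 1 = r + 2 by ring] at h3
    rw [hVsum]
    calc ∑ j ∈ Finset.Icc 1 n, (j : ℝ) ^ 2 * v n j
        ≤ ∑ j ∈ Finset.Icc 1 n, D₂ * powExp (r + 1) (δ n) j := by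
          refine Finset.sum_le_sum fun j hj => ?_
          rw [← powExp_sub_one_mul_sq, mul_left_comm D₂]
          exact mul_le_mul_of_nonneg_left (hvup n j (Finset.mem_Icc.1 hj).1) (by positivity)
      _ = D₂ * ∑ j ∈ Finset.Icc 1 n, powExp (r + 1) (δ n) j := (Finset.mul_sum _ _ _).symm
      _ ≤ D₂ * ((Real.Gamma (r + 2) + 1) * δ n ^ (-(r + 2))) :=
          mul_le_mul_of_nonneg_left ((sum_Icc_powExp_le_tsum _ h4 n).trans h3) hD₂.le
      _ = D₂ * (Real.Gamma (r + 2) + 1) * δ n ^ (-(r + 2)) := by ring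
      _ ≤ _ := by gcongr; exact le_max_right _ _
  have hthird : ∀ᶠ n : ℕ in atTop, ∑ j ∈ Finset.Icc 1 n, (j : ℝ) ^ 3 * v n j ≤
      D₂ * (Real.Gamma (r + 3) + 1) * δ n ^ (-(r + 3)) := by
    filter_upwards [hδ.eventually (eventually_tsum_powExp_le (by linarith : 0 < r + 2)), hδpos]
      with n h3 h4
    rw [show r + 2 + 1 = r + 3 by ring] at h3
    calc ∑ j ∈ Finset.Icc 1 n, (j : ℝ) ^ 3 * v n j
        ≤ ∑ j ∈ Finset.Icc 1 n, D₂ * powExp (r + 2) (δ n) j := by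
          refine Finset.sum_le_sum fun j hj => ?_
          rw [← powExp_sub_one_mul_cube, mul_left_comm D₂]
          exact mul_le_mul_of_nonneg_left (hvup n j (Finset.mem_Icc.1 hj).1) (by positivity)
      _ = D₂ * ∑ j ∈ Finset.Icc 1 n, powExp (r + 2) (δ n) j := (Finset.mul_sum _ _ _).symm
      _ ≤ D₂ * ((Real.Gamma (r + 3) + 1) * δ n ^ (-(r + 3))) :=
          mul_le_mul_of_nonneg_left ((sum_Icc_powExp_le_tsum _ h4 n).trans h3) hD₂.le
      _ = _ := by ring
  have hsqrt : ∀ {x : ℝ}, 0 < x → √(x ^ (-(r + 2))) = x ^ (-((r + 2) / 2)) := by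
    intro x hx
    rw [Real.sqrt_eq_rpow, ← Real.rpow_mul hx.le]
    congr 1; ring
  set B : ℕ → ℝ := fun n => √(V n) with hBdef
  have hBlow : ∀ᶠ n in atTop, √b * δ n ^ (-((r + 2) / 2)) ≤ B n := by
    filter_upwards [hVlow, hδpos] with n h3 h4
    rw [← hsqrt h4, ← Real.sqrt_mul hb0.le]
    exact Real.sqrt_le_sqrt h3
  have hBup : ∀ᶠ n in atTop, B n ≤ √C * δ n ^ (-((r + 2) / 2)) := by
    filter_upwards [hVup, hδpos] with n h3 h4
    rw [← hsqrt h4, ← Real.sqrt_mul hC0.le]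
    exact Real.sqrt_le_sqrt h3
  have hsb : 0 < √b := Real.sqrt_pos.2 hb0
  have hBtop : Tendsto B atTop atTop := by
    refine tendsto_atTop_mono' _ hBlow (Tendsto.const_mul_atTop hsb ?_)
    exact (tendsto_rpow_neg_nhdsGT_zero_atTop (by positivity : 0 < (r + 2) / 2)).comp hδ
  have hBpos : ∀ᶠ n in atTop, 0 < B n := hBtop.eventually_gt_atTop 0
  have hRtop : Tendsto (fun n => δ n ^ (-r)) atTop atTop :=
    (tendsto_rpow_neg_nhdsGT_zero_atTop hr).comp hδ
  set c := D₁ / 4 * c₁ / C with hc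
  have hc0 : 0 < c := by positivity
  have hBR : Tendsto (fun n => B n * Real.exp (-(c * δ n ^ (-r)))) atTop (nhds 0) := by
    have h3 := ((tendsto_rpow_neg_mul_exp_neg_mul_rpow_neg ((r + 2) / 2) hr hc0).comp hδ).const_mul
      √C
    rw [mul_zero] at h3
    refine squeeze_zero' (Eventually.of_forall fun n => by positivity) ?_ h3
    filter_upwards [hBup] with n h4
    rw [Function.comp, ← mul_assoc]
    exact mul_le_mul_of_nonneg_right h4 (Real.exp_pos _).le
  have hmain := tendsto_mul_integral_of_gaussian_limit
    (φ := fun n θ => selectionChar a n (σ n) θ) (R := fun n => δ n ^ (-r)) zero_le_one hc0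
    (Eventually.of_forall fun n => by unfold selectionChar bernoulliChar; fun_prop)
    hBtop hRtop hBR ?_ ?_
  · refine (isEquivalent_of_tendsto_mul_integral (A := fun n => Real.exp (n * σ n) *
      ∏ j ∈ Finset.Icc 1 n, (1 + Real.exp (-(j * σ n))) ^ a j) (B := B) ?_
      (Eventually.of_forall fun n => by positivity) hBpos hmain).congr_right ?_
    · filter_upwards [eventually_ge_atTop 1] with n hn
      rw [Complex.ofReal_natCast, selectionCount_eq_integral_selectionChar a hn (σ n)]
      push_cast
      rfl
    · refine Eventually.of_forall fun n => ?_
      simp only [hBdef, hV]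
      rw [Real.sqrt_mul (by positivity : 0 ≤ 2 * Real.pi) (selectionVariance a n (σ n))]
      ring
  · intro t
    rw [tendsto_iff_norm_sub_tendsto_zero]
    have h3 := ((tendsto_rpow_nhdsGT_zero (half_pos hr)).comp hδ).const_mul
      (5 * |t| ^ 3 * (D₂ * (Real.Gamma (r + 3) + 1) / √b ^ 3))
    rw [mul_zero] at h3
    refine squeeze_zero' (Eventually.of_forall fun n => norm_nonneg _) ?_ h3
    filter_upwards [hσ, hthird, hBlow, hBpos, hδpos] with n h4 h5 h6 h7 h8
    have h9 := norm_selectionChar_sub_le h4 (t / B n)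
    have h10 : -(selectionVariance a n (σ n) * (t / B n) ^ 2 / 2) = -(1 / 2) * t ^ 2 := by
      have h11 : V n = B n ^ 2 := (Real.sq_sqrt (Real.sqrt_pos.1 h7).le).symm
      change -(V n * (t / B n) ^ 2 / 2) = _
      rw [h11]
      field_simp
    rw [h10] at h9
    refine h9.trans ?_
    have hΓ : 0 < Real.Gamma (r + 3) := Real.Gamma_pos_of_pos (by linarith)
    -- The third moment falls short of B³, of order δ^{-3(r+2)/2}, by the factor δ^{r/2} → 0.
    have h12 : δ n ^ (-(r + 3)) = (δ n ^ (-((r + 2) / 2))) ^ 3 * δ n ^ (r / 2) := by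
      rw [← Real.rpow_natCast, ← Real.rpow_mul h8.le, ← Real.rpow_add h8]
      congr 1; push_cast; ring
    rw [abs_div, abs_of_pos h7, div_pow, Function.comp]
    have hv0 : 0 ≤ ∑ j ∈ Finset.Icc 1 n, (j : ℝ) ^ 3 * v n j :=
      Finset.sum_nonneg fun j _ => mul_nonneg (by positivity)
        (mul_nonneg (a j).cast_nonneg (tiltedProb_mul_one_sub_nonneg _ j))
    calc 5 * (|t| ^ 3 / B n ^ 3) * ∑ j ∈ Finset.Icc 1 n, (j : ℝ) ^ 3 * v n j
        ≤ 5 * (|t| ^ 3 / (√b * δ n ^ (-((r + 2) / 2))) ^ 3) *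
          (D₂ * (Real.Gamma (r + 3) + 1) * δ n ^ (-(r + 3))) := by gcongr
      _ = _ := by rw [h12]; field_simp
  · filter_upwards [hvlow, hVup, hBpos, hδpos, hδone, hnδ.eventually_ge_atTop 12]
      with n h3 h4 h5 h6 h7 h8 θ hθ
    rw [one_mul]
    refine (norm_selectionChar_le a n (σ n) θ).trans (Real.exp_le_exp.2 (neg_le_neg ?_))
    have h9 := hcos (δ n) h6 h7 n h8 θ hθ
    have h10 : (B n * θ) ^ 2 ≤ C * (θ ^ 2 * δ n ^ (-(r + 2))) := by
      have h11 : B n ^ 2 = V n := Real.sq_sqrt (Real.sqrt_pos.1 h5).le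
      rw [mul_pow, h11]
      nlinarith [mul_le_mul_of_nonneg_right h4 (sq_nonneg θ)]
    have hC1 : 1 ≤ C := le_max_left _ _
    have h12 : min ((B n * θ) ^ 2) (δ n ^ (-r)) ≤
        C * min (θ ^ 2 * δ n ^ (-(r + 2))) (δ n ^ (-r)) := by
      rw [mul_min_of_nonneg _ _ hC0.le]
      refine min_le_min h10 ?_
      have : 0 ≤ δ n ^ (-r) := by positivity
      nlinarith
    calc c * min ((B n * θ) ^ 2) (δ n ^ (-r))
        ≤ c * (C * min (θ ^ 2 * δ n ^ (-(r + 2))) (δ n ^ (-r))) := by gcongr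
      _ = D₁ / 4 * (c₁ * min (θ ^ 2 * δ n ^ (-(r + 2))) (δ n ^ (-r))) := by
          rw [hc]; field_simp
      _ ≤ D₁ / 4 * ∑ j ∈ Finset.Icc 1 n, powExp (r - 1) (δ n) j * (1 - Real.cos (j * θ)) := by
          gcongr
      _ ≤ _ := by
          rw [Finset.mul_sum]
          refine Finset.sum_le_sum fun j _ => ?_
          rw [← mul_assoc]
          exact mul_le_mul_of_nonneg_right (h3 j) (by linarith [Real.cos_le_one (j * θ)])

/-! ### The integral at the leading order saddle point -/

/-- Here nδ is a multiple of δ^{-r}, so the tail factor e^{-nδ/2} beats every power of 1/δ. -/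
theorem tendsto_tsum_powExp_sub_sum_Icc {r g : ℝ} (s : ℝ) (hr : 0 < r) (hg : 0 < g) {δ : ℕ → ℝ}
    (hδ : Tendsto δ atTop (nhdsWithin 0 (Set.Ioi 0)))
    (hn : ∀ᶠ n : ℕ in atTop, n * δ n = g * δ n ^ (-r)) :
    Tendsto (fun n => ∑' j, powExp s (δ n) j - ∑ j ∈ Finset.Icc 1 n, powExp s (δ n) j) atTop
      (nhds 0) := by
  have hδpos : ∀ᶠ n in atTop, 0 < δ n := hδ.eventually self_mem_nhdsWithin
  -- Raising the exponent to a positive q only increases the sum and makes the asymptotic bound for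
  -- positive exponents available.
  set q := s + (|s| + 1) with hq
  have hq0 : 0 < q := by linarith [neg_abs_le s]
  have hhalf : Tendsto (fun n => δ n / 2) atTop (nhdsWithin 0 (Set.Ioi 0)) := by
    refine tendsto_nhdsWithin_iff.2 ⟨?_, hδpos.mono fun n h => half_pos h⟩
    simpa using (hδ.mono_right nhdsWithin_le_nhds).div_const 2
  have h0 := ((tendsto_rpow_neg_mul_exp_neg_mul_rpow_neg (q + 1) hr (half_pos hg)).comp hδ).const_mul
    ((Real.Gamma (q + 1) + 1) * 2 ^ (q + 1))
  rw [mul_zero] at h0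
  refine squeeze_zero' ?_ ?_ h0
  · filter_upwards [hδpos] with n h
    linarith [sum_Icc_powExp_le_tsum s h n]
  · filter_upwards [hδpos, hn, hhalf.eventually (eventually_tsum_powExp_le hq0)] with n h1 h2 h3
    refine (tsum_powExp_sub_sum_Icc_le s h1 n).trans ?_
    have h4 : ∑' j, powExp s (δ n / 2) j ≤ ∑' j, powExp q (δ n / 2) j :=
      (summable_powExp s (half_pos h1)).tsum_le_tsum
        (fun j => powExp_le_powExp_add (by positivity) j) (summable_powExp q (half_pos h1))
    have h5 : (δ n / 2) ^ (-(q + 1)) = 2 ^ (q + 1) * δ n ^ (-(q + 1)) := by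
      rw [Real.div_rpow h1.le zero_le_two, Real.rpow_neg zero_le_two, div_inv_eq_mul, mul_comm]
    rw [← mul_div_assoc, h2, Function.comp, mul_div_right_comm]
    calc _ ≤ Real.exp (-(g / 2 * δ n ^ (-r))) *
          ((Real.Gamma (q + 1) + 1) * (2 ^ (q + 1) * δ n ^ (-(q + 1)))) := by
          rw [← h5]
          exact mul_le_mul_of_nonneg_left (h4.trans h3) (Real.exp_pos _).le
      _ = _ := by ring

/-- Tannery's theorem, with the range of summation and the argument varying together. Continuity up
to the boundary is needed, since the limit point z = 1 lies on the unit circle. -/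
theorem tendsto_sum_Icc_of_dominated {h : ℕ → ℂ → ℂ} {u : ℕ → ℝ} (hu : Summable u)
    (hb : ∀ j, 1 ≤ j → ∀ z, ‖z‖ ≤ 1 → ‖h j z‖ ≤ u j)
    (hc : ∀ j, 1 ≤ j → ContinuousOn (h j) (Metric.closedBall 0 1)) {H : ℂ}
    (hH : HasSum (fun j => if j = 0 then 0 else h j 1) H) {z : ℕ → ℂ}
    (hz : ∀ᶠ n in atTop, ‖z n‖ ≤ 1) (hz1 : Tendsto z atTop (nhds 1)) :
    Tendsto (fun n => ∑ j ∈ Finset.Icc 1 n, h j (z n)) atTop (nhds H) := by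
  have hsum : ∀ n, ∑' j, (if j ∈ Finset.Icc 1 n then h j (z n) else 0) =
      ∑ j ∈ Finset.Icc 1 n, h j (z n) := by
    intro n
    rw [tsum_eq_sum (s := Finset.Icc 1 n) fun j hj => if_neg hj]
    exact Finset.sum_congr rfl fun j hj => if_pos hj
  simp only [← hsum]
  rw [← hH.tsum_eq]
  refine tendsto_tsum_of_dominated_convergence hu.norm (fun j => ?_) ?_
  · rcases Nat.eq_zero_or_pos j with rfl | hj
    · simp
    · rw [if_neg hj.ne']
      have h1 : ContinuousWithinAt (h j) (Metric.closedBall 0 1) 1 := hc j hj 1 (by simp)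
      have h2 : Tendsto z atTop (nhdsWithin 1 (Metric.closedBall 0 1)) :=
        tendsto_nhdsWithin_iff.2 ⟨hz1, hz.mono fun n hn => by simpa using hn⟩
      refine (h1.tendsto.comp h2).congr' ?_
      filter_upwards [eventually_ge_atTop j] with n hn
      rw [if_pos (Finset.mem_Icc.2 ⟨hj, hn⟩)]
      rfl
  · filter_upwards [hz] with n hn j
    split_ifs with hj
    · exact (hb j (Finset.mem_Icc.1 hj).1 _ hn).trans (le_abs_self _)
    · simp

/-- Saddle point asymptotics of the Fourier coefficients of `exp (K ∑ j^{r-1} z^j + ∑ h_j(z))`,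
on circles whose radii satisfy the leading order saddle point equation. -/
theorem tendsto_mul_integral_exp {K r : ℝ} (hK : 0 < K) (hr : 0 < r) {δ : ℕ → ℝ}
    (hδ : Tendsto δ atTop (nhdsWithin 0 (Set.Ioi 0)))
    (hn : ∀ᶠ n : ℕ in atTop, (n : ℝ) = K * Real.Gamma (r + 1) * δ n ^ (-(r + 1)))
    {h : ℕ → ℂ → ℂ} {u : ℕ → ℝ} (hu : Summable u)
    (hb : ∀ j, 1 ≤ j → ∀ z, ‖z‖ ≤ 1 → ‖h j z‖ ≤ u j)
    (hc : ∀ j, 1 ≤ j → ContinuousOn (h j) (Metric.closedBall 0 1)) {H : ℂ}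
    (hH : HasSum (fun j => if j = 0 then 0 else h j 1) H) :
    Tendsto (fun n : ℕ => ((√(K * Real.Gamma (r + 2)) * δ n ^ (-((r + 2) / 2)) : ℝ) : ℂ) *
      ∫ θ in (-Real.pi)..Real.pi, Complex.exp
        (∑ j ∈ Finset.Icc 1 n, (K * powExp (r - 1) (δ n) j : ℝ) *
            (Complex.exp ((j * θ : ℝ) * Complex.I) - 1) +
          (∑ j ∈ Finset.Icc 1 n, h j (Complex.exp (-δ n + θ * Complex.I)) - H) -
          n * θ * Complex.I)) atTop (nhds (√(2 * Real.pi) : ℝ)) := by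
  have hδpos : ∀ᶠ n in atTop, 0 < δ n := hδ.eventually self_mem_nhdsWithin
  have hδ0 : Tendsto δ atTop (nhds 0) := hδ.mono_right nhdsWithin_le_nhds
  have hδone : ∀ᶠ n in atTop, δ n ≤ 1 := hδ0.eventually_le_const one_pos
  have hΓ1 : 0 < Real.Gamma (r + 1) := Real.Gamma_pos_of_pos (by linarith)
  have hΓ2 : 0 < Real.Gamma (r + 2) := Real.Gamma_pos_of_pos (by linarith)
  have hΓ3 : 0 < Real.Gamma (r + 3) := Real.Gamma_pos_of_pos (by linarith)
  set g := K * Real.Gamma (r + 1) with hg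
  have hg0 : 0 < g := by positivity
  have hnδ : ∀ᶠ n : ℕ in atTop, n * δ n = g * δ n ^ (-r) := by
    filter_upwards [hn, hδpos] with n h1 h2
    rw [h1, mul_assoc, ← Real.rpow_add_one h2.ne']
    congr 2; ring
  have hRtop : Tendsto (fun n => δ n ^ (-r)) atTop atTop :=
    (tendsto_rpow_neg_nhdsGT_zero_atTop hr).comp hδ
  have hnδtop : Tendsto (fun n : ℕ => n * δ n) atTop atTop :=
    (hRtop.const_mul_atTop hg0).congr' (hnδ.mono fun n h => h.symm)
  have htail := fun s => tendsto_tsum_powExp_sub_sum_Icc s hr hg0 hδ hnδ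
  obtain ⟨c₁, hc₁, hcos⟩ := exists_le_sum_powExp_mul_one_sub_cos r
  set G := K * Real.Gamma (r + 2) with hG
  have hG0 : 0 < G := by positivity
  have hsG : 0 < √G := Real.sqrt_pos.2 hG0
  set B : ℕ → ℝ := fun n => √G * δ n ^ (-((r + 2) / 2)) with hB
  have hBpos : ∀ᶠ n in atTop, 0 < B n := hδpos.mono fun n h => by
    simp only [hB]; positivity
  have hBtop : Tendsto B atTop atTop :=
    ((tendsto_rpow_neg_nhdsGT_zero_atTop (by positivity : 0 < (r + 2) / 2)).comp hδ).const_mul_atTop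
      hsG
  have hBsq : ∀ᶠ n in atTop, B n ^ 2 = G * δ n ^ (-(r + 2)) := by
    filter_upwards [hδpos] with n h1
    simp only [hB]
    rw [mul_pow, Real.sq_sqrt hG0.le, ← Real.rpow_natCast, ← Real.rpow_mul h1.le]
    congr 2; push_cast; ring
  set C := max 1 G with hC
  have hC1 : 1 ≤ C := le_max_left _ _
  have hC0 : 0 < C := by linarith
  set c := K * c₁ / C with hc'
  have hc0 : 0 < c := by positivity
  have hBR : Tendsto (fun n => B n * Real.exp (-(c * δ n ^ (-r)))) atTop (nhds 0) := by
    have h3 := ((tendsto_rpow_neg_mul_exp_neg_mul_rpow_neg ((r + 2) / 2) hr hc0).comp hδ).const_mul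
      √G
    rw [mul_zero] at h3
    refine h3.congr fun n => ?_
    simp only [hB, Function.comp]
    ring
  -- The remainders stay bounded on the whole circle, so away from the saddle they cost only a
  -- constant factor.
  set U := Real.exp (∑' j, |u j| + ‖H‖) with hU
  have hsumh : ∀ (n : ℕ) (z : ℂ), ‖z‖ ≤ 1 → ‖∑ j ∈ Finset.Icc 1 n, h j z‖ ≤ ∑' j, |u j| := by
    intro n z hz
    refine (norm_sum_le _ _).trans (le_trans (Finset.sum_le_sum fun j hj => ?_)
      (hu.abs.sum_le_tsum (Finset.Icc 1 n) fun j _ => abs_nonneg _))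
    exact (hb j (Finset.mem_Icc.1 hj).1 z hz).trans (le_abs_self _)
  have hznorm : ∀ n (θ : ℝ), ‖Complex.exp (-δ n + θ * Complex.I)‖ = Real.exp (-δ n) := by
    intro n θ
    rw [Complex.norm_exp]; simp
  refine tendsto_mul_integral_of_gaussian_limit (R := fun n => δ n ^ (-r)) (C := U) (c := c)
    (Real.exp_pos _).le hc0 ?_ hBtop hRtop hBR ?_ ?_
  · filter_upwards [hδpos] with n h1
    refine Complex.continuous_exp.comp ?_
    refine Continuous.sub (Continuous.add (by fun_prop) (Continuous.sub ?_ continuous_const))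
      (by fun_prop)
    refine continuous_finsetSum _ fun j hj => ?_
    refine (hc j (Finset.mem_Icc.1 hj).1).comp_continuous (by fun_prop) fun θ => ?_
    rw [mem_closedBall_zero_iff, hznorm]
    exact Real.exp_le_one_iff.2 (by linarith)
  · intro t
    set θ : ℕ → ℝ := fun n => t / B n with hθ
    have hθ0 : Tendsto θ atTop (nhds 0) := hBtop.const_div_atTop t
    set T : ℝ → ℕ → ℝ := fun s n => ∑ j ∈ Finset.Icc 1 n, powExp s (δ n) j with hT
    -- first moment
    have h1 : Tendsto (fun n : ℕ => θ n * (K * T r n - n)) atTop (nhds 0) := by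
      obtain ⟨D, hD⟩ := exists_abs_tsum_powExp_sub_le hr
      -- The leading order δ solves the saddle point equation up to O(1), D from Poisson summation
      -- and 1 from the truncated tail. As θ → 0, the resulting phase disappears.
      have h2 : ∀ᶠ n : ℕ in atTop, |K * T r n - n| ≤ K * (D + 1) := by
        have h3 := ((htail r).norm).eventually_le_const (u := 1) (by simp)
        filter_upwards [h3, hn, hδpos] with n h4 h5 h6
        rw [h5, hg, mul_assoc, ← mul_sub, abs_mul, abs_of_pos hK]
        refine mul_le_mul_of_nonneg_left ?_ hK.le
        have h7 := hD (δ n) h6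
        rw [Real.norm_eq_abs] at h4
        rw [show T r n - Real.Gamma (r + 1) * δ n ^ (-(r + 1)) =
          (∑' j, powExp r (δ n) j - Real.Gamma (r + 1) * δ n ^ (-(r + 1))) -
          (∑' j, powExp r (δ n) j - T r n) by ring]
        refine (abs_sub _ _).trans (add_le_add h7 h4)
      have h3 := (hθ0.norm).mul_const (K * (D + 1))
      rw [norm_zero, zero_mul] at h3
      refine squeeze_zero_norm' ?_ h3
      filter_upwards [h2] with n h4
      rw [norm_mul]
      exact mul_le_mul_of_nonneg_left h4 (norm_nonneg _)
    -- second moment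
    have h2 : Tendsto (fun n : ℕ => K * T (r + 1) n * θ n ^ 2 / 2) atTop (nhds (1 / 2 * t ^ 2)) := by
      have h3 := ((tendsto_tsum_powExp_mul_rpow (by linarith : 0 < r + 1)).comp hδ).sub
        ((htail (r + 1)).mul ((tendsto_rpow_nhdsGT_zero (by linarith : 0 < r + 2)).comp hδ))
      have h4 := h3.mul_const (K * t ^ 2 / (2 * G))
      rw [zero_mul, sub_zero, show r + 1 + 1 = r + 2 by ring] at h4
      rw [show 1 / 2 * t ^ 2 = Real.Gamma (r + 2) * (K * t ^ 2 / (2 * G)) by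
        rw [hG]; field_simp]
      refine h4.congr' ?_
      filter_upwards [hδpos, hBsq] with n h5 h6
      simp only [Function.comp, hθ]
      rw [div_pow, h6, Real.rpow_neg h5.le]
      have : 0 < δ n ^ (r + 2) := by positivity
      field_simp
      ring
    -- third moment
    have h3 : Tendsto (fun n : ℕ => 4 * |θ n| ^ 3 * (K * T (r + 2) n)) atTop (nhds 0) := by
      have h4 := ((tendsto_rpow_nhdsGT_zero (half_pos hr)).comp hδ).const_mul
        (4 * |t| ^ 3 * (K * (Real.Gamma (r + 3) + 1) / √G ^ 3))
      rw [mul_zero] at h4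
      refine squeeze_zero' (Eventually.of_forall fun n => ?_) ?_ h4
      · exact mul_nonneg (by positivity)
          (mul_nonneg hK.le (Finset.sum_nonneg fun j _ => powExp_nonneg _ _ _))
      · filter_upwards [hδpos, hBpos, hδ.eventually (eventually_tsum_powExp_le
          (by linarith : 0 < r + 2))] with n h5 h6 h7
        rw [show r + 2 + 1 = r + 3 by ring] at h7
        have h8 : T (r + 2) n ≤ (Real.Gamma (r + 3) + 1) * δ n ^ (-(r + 3)) :=
          (sum_Icc_powExp_le_tsum _ h5 n).trans h7
        have h12 : δ n ^ (-(r + 3)) = (δ n ^ (-((r + 2) / 2))) ^ 3 * δ n ^ (r / 2) := by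
          rw [← Real.rpow_natCast, ← Real.rpow_mul h5.le, ← Real.rpow_add h5]
          congr 1; push_cast; ring
        simp only [hθ, Function.comp]
        rw [abs_div, abs_of_pos h6, div_pow]
        calc 4 * (|t| ^ 3 / B n ^ 3) * (K * T (r + 2) n)
            ≤ 4 * (|t| ^ 3 / B n ^ 3) * (K * ((Real.Gamma (r + 3) + 1) * δ n ^ (-(r + 3)))) := by
              gcongr
          _ = _ := by
              rw [h12]
              simp only [hB]
              have : 0 < δ n ^ (-((r + 2) / 2)) := by positivity
              field_simp
    have h4 : Tendsto (fun n => ∑ j ∈ Finset.Icc 1 n, h j (Complex.exp (-δ n + θ n * Complex.I)) - H)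
        atTop (nhds 0) := by
      rw [← sub_self H]
      refine Tendsto.sub_const (tendsto_sum_Icc_of_dominated hu hb hc hH ?_ ?_) H
      · filter_upwards [hδpos] with n h5
        rw [hznorm]
        exact Real.exp_le_one_iff.2 (by linarith)
      · have h5 : Tendsto (fun n => -(δ n : ℂ) + θ n * Complex.I) atTop
            (nhds (-((0 : ℝ) : ℂ) + ((0 : ℝ) : ℂ) * Complex.I)) :=
          ((Complex.continuous_ofReal.tendsto 0).comp hδ0).neg.add
            (((Complex.continuous_ofReal.tendsto 0).comp hθ0).mul_const Complex.I)
        have h6 := (Complex.continuous_exp.tendsto _).comp h5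
        simpa [Function.comp_def] using h6
    have h5 : Tendsto (fun n => ∑ j ∈ Finset.Icc 1 n, ((K * powExp (r - 1) (δ n) j : ℝ) : ℂ) *
        (Complex.exp ((j * θ n : ℝ) * Complex.I) -
          (1 + (j * θ n : ℝ) * Complex.I - ((j * θ n : ℝ) : ℂ) ^ 2 / 2))) atTop (nhds 0) := by
      refine squeeze_zero_norm (fun n => ?_) h3
      refine (norm_sum_le _ _).trans ?_
      simp only [hT]
      rw [Finset.mul_sum, Finset.mul_sum]
      refine Finset.sum_le_sum fun j _ => ?_
      have h6 : 0 ≤ K * powExp (r - 1) (δ n) j := mul_nonneg hK.le (powExp_nonneg _ _ _)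
      rw [norm_mul, Complex.norm_real, Real.norm_of_nonneg h6]
      refine (mul_le_mul_of_nonneg_left (norm_exp_mul_I_sub_taylor_le _) h6).trans (le_of_eq ?_)
      rw [abs_mul, Nat.abs_cast, ← powExp_sub_one_mul_cube]
      ring
    have hθn : ∀ n, t / (√G * δ n ^ (-((r + 2) / 2))) = θ n := fun n => rfl
    clear_value θ
    have h6 := (((Complex.continuous_ofReal.tendsto _).comp h1).mul_const Complex.I).sub
      ((Complex.continuous_ofReal.tendsto _).comp h2)
    have h7 := (h5.add h6).add h4
    have h8 := (Complex.continuous_exp.tendsto _).comp h7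
    have h9 : Complex.exp (0 + (((0 : ℝ) : ℂ) * Complex.I - ((1 / 2 * t ^ 2 : ℝ) : ℂ)) + 0) =
        ((Real.exp (-(1 / 2) * t ^ 2) : ℝ) : ℂ) := by
      push_cast
      congr 1; ring
    rw [h9] at h8
    refine h8.congr fun n => ?_
    simp only [Function.comp, hθn]
    congr 1
    have h10 : ∑ j ∈ Finset.Icc 1 n, ((K * powExp (r - 1) (δ n) j : ℝ) : ℂ) *
        (Complex.exp ((j * θ n : ℝ) * Complex.I) - 1) =
        ∑ j ∈ Finset.Icc 1 n, ((K * powExp (r - 1) (δ n) j : ℝ) : ℂ) *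
        (Complex.exp ((j * θ n : ℝ) * Complex.I) -
          (1 + (j * θ n : ℝ) * Complex.I - ((j * θ n : ℝ) : ℂ) ^ 2 / 2)) +
        ((K * T r n * θ n : ℝ) * Complex.I - (K * T (r + 1) n * θ n ^ 2 / 2 : ℝ)) := by
      simp only [hT]
      rw [Finset.mul_sum, Finset.mul_sum, Finset.sum_mul, Finset.sum_mul, Finset.sum_div]
      push_cast
      rw [Finset.sum_mul, ← Finset.sum_sub_distrib, ← Finset.sum_add_distrib]
      refine Finset.sum_congr rfl fun j _ => ?_
      rw [← powExp_sub_one_mul_sq, ← powExp_sub_one_mul r]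
      push_cast
      ring
    rw [h10]
    push_cast
    ring
  · filter_upwards [hδpos, hδone, hnδtop.eventually_ge_atTop 12, hBsq] with n h1 h2 h3 h4 θ hθ
    have h9 := hcos (δ n) h1 h2 n h3 θ hθ
    have h10 : (B n * θ) ^ 2 ≤ C * (θ ^ 2 * δ n ^ (-(r + 2))) := by
      rw [mul_pow, h4]
      have h11 : G * (θ ^ 2 * δ n ^ (-(r + 2))) ≤ C * (θ ^ 2 * δ n ^ (-(r + 2))) :=
        mul_le_mul_of_nonneg_right (le_max_right _ _) (by positivity)
      linarith
    have h12 : min ((B n * θ) ^ 2) (δ n ^ (-r)) ≤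
        C * min (θ ^ 2 * δ n ^ (-(r + 2))) (δ n ^ (-r)) := by
      rw [mul_min_of_nonneg _ _ hC0.le]
      refine min_le_min h10 ?_
      have : 0 ≤ δ n ^ (-r) := by positivity
      nlinarith
    have h13 : c * min ((B n * θ) ^ 2) (δ n ^ (-r)) ≤
        K * ∑ j ∈ Finset.Icc 1 n, powExp (r - 1) (δ n) j * (1 - Real.cos (j * θ)) := by
      calc c * min ((B n * θ) ^ 2) (δ n ^ (-r))
          ≤ c * (C * min (θ ^ 2 * δ n ^ (-(r + 2))) (δ n ^ (-r))) := by gcongr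
        _ = K * (c₁ * min (θ ^ 2 * δ n ^ (-(r + 2))) (δ n ^ (-r))) := by
            rw [hc']; field_simp
        _ ≤ _ := by gcongr
    rw [Complex.norm_exp, ← Real.exp_add]
    refine Real.exp_le_exp.2 ?_
    rw [Complex.sub_re, Complex.add_re, Complex.re_sum]
    have h14 : ∀ j : ℕ, (((K * powExp (r - 1) (δ n) j : ℝ) : ℂ) *
        (Complex.exp ((j * θ : ℝ) * Complex.I) - 1)).re =
        -(K * (powExp (r - 1) (δ n) j * (1 - Real.cos (j * θ)))) := by
      intro j
      rw [Complex.re_ofReal_mul, Complex.sub_re, Complex.exp_ofReal_mul_I_re, Complex.one_re]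
      ring
    have h15 : (n * θ * Complex.I : ℂ).re = 0 := by simp
    have h16 : (∑ j ∈ Finset.Icc 1 n, h j (Complex.exp (-δ n + θ * Complex.I)) - H).re ≤
        ∑' j, |u j| + ‖H‖ := by
      refine (Complex.re_le_norm _).trans ((norm_sub_le _ _).trans (add_le_add_left ?_ _))
      refine hsumh n _ ?_
      rw [hznorm]
      exact Real.exp_le_one_iff.2 (by linarith)
    rw [h15, Finset.sum_congr rfl fun j _ => h14 j, Finset.sum_neg_distrib, ← Finset.mul_sum]
    linarith

/-! ### The explicit growth rate -/

/-- The leading order solution `δ` of the saddle point equation `K Γ(r+1) δ^{-(r+1)} = n`. -/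
noncomputable def leadingSaddle (K r : ℝ) (n : ℕ) : ℝ := (K * Real.Gamma (r + 1) / n) ^ (1 / (r + 1))

theorem leadingSaddle_pos {K r : ℝ} (hK : 0 < K) (hr : 0 < r) {n : ℕ} (hn : 1 ≤ n) :
    0 < leadingSaddle K r n := by
  have hΓ : 0 < Real.Gamma (r + 1) := Real.Gamma_pos_of_pos (by linarith)
  have : (0 : ℝ) < n := by exact_mod_cast hn
  unfold leadingSaddle
  positivity

theorem leadingSaddle_rpow {K r : ℝ} (hK : 0 < K) (hr : 0 < r) {n : ℕ} (hn : 1 ≤ n) (p : ℝ) :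
    leadingSaddle K r n ^ p =
      (K * Real.Gamma (r + 1)) ^ (p / (r + 1)) * (n : ℝ) ^ (-(p / (r + 1))) := by
  have hΓ : 0 < Real.Gamma (r + 1) := Real.Gamma_pos_of_pos (by linarith)
  have hn0 : (0 : ℝ) < n := by exact_mod_cast hn
  rw [leadingSaddle, ← Real.rpow_mul (by positivity), one_div_mul_eq_div,
    Real.div_rpow (by positivity) hn0.le, Real.rpow_neg hn0.le, div_eq_mul_inv]

theorem eq_mul_leadingSaddle_rpow {K r : ℝ} (hK : 0 < K) (hr : 0 < r) {n : ℕ} (hn : 1 ≤ n) :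
    (n : ℝ) = K * Real.Gamma (r + 1) * leadingSaddle K r n ^ (-(r + 1)) := by
  have hΓ : 0 < Real.Gamma (r + 1) := Real.Gamma_pos_of_pos (by linarith)
  have hr1 : r + 1 ≠ 0 := by linarith
  rw [leadingSaddle_rpow hK hr hn, neg_div, div_self hr1, neg_neg, Real.rpow_one, Real.rpow_neg_one]
  field_simp

theorem tendsto_leadingSaddle {K r : ℝ} (hK : 0 < K) (hr : 0 < r) :
    Tendsto (leadingSaddle K r) atTop (nhdsWithin 0 (Set.Ioi 0)) := by
  refine tendsto_nhdsWithin_iff.2 ⟨?_, ?_⟩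
  · have h1 : Tendsto (fun n : ℕ => K * Real.Gamma (r + 1) / n) atTop (nhds 0) :=
      tendsto_natCast_atTop_atTop.const_div_atTop _
    have h2 : 0 < 1 / (r + 1) := by positivity
    have h3 := (Real.continuousAt_rpow_const 0 (1 / (r + 1)) (Or.inr h2.le)).tendsto.comp h1
    rwa [Real.zero_rpow h2.ne'] at h3
  · filter_upwards [eventually_ge_atTop 1] with n hn using leadingSaddle_pos hK hr hn

/-- By the saddle point equation both summands are multiples of δ^{-r}, namely KΓ(r+1)δ^{-r} and 1/r
times it, and δ^{-r} is an explicit power of n. -/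
theorem leadingSaddle_exponent {K r : ℝ} (hK : 0 < K) (hr : 0 < r) {n : ℕ} (hn : 1 ≤ n) :
    n * leadingSaddle K r n + K * (Real.Gamma r * leadingSaddle K r n ^ (-r)) =
      (r + 1) / r * (K * Real.Gamma (r + 1)) ^ (1 / (r + 1)) * (n : ℝ) ^ (r / (r + 1)) := by
  have hΓ : 0 < Real.Gamma (r + 1) := Real.Gamma_pos_of_pos (by linarith)
  have hδ := leadingSaddle_pos hK hr hn
  have h1 : n * leadingSaddle K r n =
      K * Real.Gamma (r + 1) * leadingSaddle K r n ^ (-r) := by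
    conv_lhs => rw [eq_mul_leadingSaddle_rpow hK hr hn]
    rw [mul_assoc, ← Real.rpow_add_one hδ.ne']
    congr 2; ring
  have h2 : K * (Real.Gamma r * leadingSaddle K r n ^ (-r)) =
      K * Real.Gamma (r + 1) * leadingSaddle K r n ^ (-r) / r := by
    rw [Real.Gamma_add_one hr.ne']
    field_simp
  have h3 : (K * Real.Gamma (r + 1)) ^ (1 / (r + 1)) =
      K * Real.Gamma (r + 1) * (K * Real.Gamma (r + 1)) ^ (-r / (r + 1)) := by
    rw [mul_comm (K * Real.Gamma (r + 1)), ← Real.rpow_add_one (by positivity)]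
    congr 1
    field_simp
    ring
  rw [h1, h2, leadingSaddle_rpow hK hr hn, h3, neg_div, neg_neg]
  field_simp

/-- The constant C₀ is chosen before the remainders h, so multisets and selections share it and
their constants are compared through H alone. -/
theorem exists_isEquivalent_explicitGrowth {K r y : ℝ} (hK : 0 < K) (hr : 0 < r) (hy : 0 < y) :
    ∃ C₀ : ℝ, 0 < C₀ ∧ ∀ (h : ℕ → ℂ → ℂ) (u : ℕ → ℝ) (H : ℝ) (c : ℕ → ℝ), Summable u →
      (∀ j, 1 ≤ j → ∀ z, ‖z‖ ≤ 1 → ‖h j z‖ ≤ u j) →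
      (∀ j, 1 ≤ j → ContinuousOn (h j) (Metric.closedBall 0 1)) →
      HasSum (fun j => if j = 0 then 0 else h j 1) (H : ℂ) →
      (∀ᶠ n : ℕ in atTop, (c n : ℂ) =
        Real.exp (n * (Real.log y + leadingSaddle K r n)) / (2 * Real.pi) *
          ∫ θ in (-Real.pi)..Real.pi, Complex.exp
            (∑ j ∈ Finset.Icc 1 n, (K * powExp (r - 1) (leadingSaddle K r n) j : ℝ) *
              Complex.exp ((j * θ : ℝ) * Complex.I) +
            ∑ j ∈ Finset.Icc 1 n, h j (Complex.exp (-leadingSaddle K r n + θ * Complex.I))) *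
            Complex.exp (-(n * θ * Complex.I))) →
      c ~[atTop] fun n => C₀ * Real.exp H * explicitGrowth K r y n := by
  have hΓ1 : 0 < Real.Gamma (r + 1) := Real.Gamma_pos_of_pos (by linarith)
  have hΓ2 : 0 < Real.Gamma (r + 2) := Real.Gamma_pos_of_pos (by linarith)
  obtain ⟨ζ, hζ⟩ := exists_tendsto_tsum_powExp_sub hr
  set δ := leadingSaddle K r with hδdef
  have hδ : Tendsto δ atTop (nhdsWithin 0 (Set.Ioi 0)) := tendsto_leadingSaddle hK hr
  have hn : ∀ᶠ n : ℕ in atTop, (n : ℝ) = K * Real.Gamma (r + 1) * δ n ^ (-(r + 1)) := by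
    filter_upwards [eventually_ge_atTop 1] with n h1 using eq_mul_leadingSaddle_rpow hK hr h1
  have hnδ : ∀ᶠ n : ℕ in atTop, n * δ n = K * Real.Gamma (r + 1) * δ n ^ (-r) := by
    filter_upwards [hn, eventually_ge_atTop 1] with n h1 h2
    rw [h1, mul_assoc, ← Real.rpow_add_one (leadingSaddle_pos hK hr h2).ne']
    congr 2; ring
  set T : ℕ → ℝ := fun n => ∑ j ∈ Finset.Icc 1 n, powExp (r - 1) (δ n) j with hT
  have hTlim : Tendsto (fun n => T n - Real.Gamma r * δ n ^ (-r)) atTop (nhds ζ) := by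
    have h1 := (hζ.comp hδ).sub
      (tendsto_tsum_powExp_sub_sum_Icc (r - 1) hr (by positivity) hδ hnδ)
    rw [sub_zero] at h1
    refine h1.congr fun n => ?_
    simp only [Function.comp, hT]
    ring
  set D := √(K * Real.Gamma (r + 2)) with hD
  have hD0 : 0 < D := Real.sqrt_pos.2 (by positivity)
  -- The factor e^{Kζ} comes from the constant term of ∑ j^{r-1} e^{-jδ}; the rest is 1/(√(2π) B)
  -- without its power of n.
  refine ⟨Real.exp (K * ζ) * (K * Real.Gamma (r + 1)) ^ ((r + 2) / 2 / (r + 1)) /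
    (√(2 * Real.pi) * D), by positivity, fun h u H c hu hb hc hH hcn => ?_⟩
  have hmain := tendsto_mul_integral_exp hK hr hδ hn hu hb hc hH
  have hpos : ∀ᶠ n in atTop, 0 < D * δ n ^ (-((r + 2) / 2)) := by
    filter_upwards [eventually_ge_atTop 1] with n h1
    have := leadingSaddle_pos hK hr h1
    positivity
  have hequiv := isEquivalent_of_tendsto_mul_integral (c := c)
    (A := fun n => Real.exp (n * (Real.log y + δ n)) * Real.exp (K * T n + H)) ?_
    (Eventually.of_forall fun n => by positivity) hpos hmain
  · refine hequiv.trans ?_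
    rw [isEquivalent_iff_exists_eq_mul]
    -- The sum T sits in an exponent, so it is needed up to o(1) and not merely to leading order.
    refine ⟨fun n => Real.exp (K * (T n - Real.Gamma r * δ n ^ (-r)) - K * ζ), ?_, ?_⟩
    · have h1 := (hTlim.const_mul K).sub_const (K * ζ)
      rw [sub_self] at h1
      simpa [Function.comp_def] using (Real.continuous_exp.tendsto 0).comp h1
    · filter_upwards [eventually_ge_atTop 1] with n h1
      have hδn : 0 < δ n := leadingSaddle_pos hK hr h1
      have h2 : Real.exp (n * (Real.log y + δ n)) * Real.exp (K * T n + H) =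
          Real.exp (K * (T n - Real.Gamma r * δ n ^ (-r)) - K * ζ) * (Real.exp (K * ζ) *
            Real.exp H * (y ^ n * Real.exp (n * δ n + K * (Real.Gamma r * δ n ^ (-r))))) := by
        rw [← Real.exp_log (pow_pos hy n), Real.log_pow]
        simp only [← Real.exp_add]
        congr 1; ring
      have h3 : (δ n ^ (-((r + 2) / 2)))⁻¹ = (K * Real.Gamma (r + 1)) ^ ((r + 2) / 2 / (r + 1)) *
          (n : ℝ) ^ (-((r + 2) / (2 * (r + 1)))) := by
        rw [← Real.rpow_neg hδn.le, neg_neg, hδdef, leadingSaddle_rpow hK hr h1, div_div]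
      simp only [Pi.mul_apply]
      rw [h2, leadingSaddle_exponent hK hr h1, explicitGrowth, div_eq_mul_inv _ (√(2 * Real.pi) * _),
        mul_inv, mul_inv, h3]
      field_simp
  · filter_upwards [hcn] with n h1
    rw [h1]
    have h2 : ((Real.exp (n * (Real.log y + δ n)) * Real.exp (K * T n + H) / (2 * Real.pi) : ℝ) : ℂ) =
        Real.exp (n * (Real.log y + δ n)) / (2 * Real.pi) * Complex.exp (K * T n + H) := by
      push_cast; ring
    rw [h2, mul_assoc]
    congr 1
    rw [← intervalIntegral.integral_const_mul]
    congr 1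
    funext θ
    rw [← Complex.exp_add, ← Complex.exp_add]
    congr 1
    simp only [hT, mul_sub, Finset.sum_sub_distrib, mul_one]
    push_cast
    rw [Finset.mul_sum]
    ring

/-! ### Logarithms of the factors and their summable remainders -/

/-- The logarithm `ε a_j log (1 + ε (z/y)^j)` of the `j`-th factor of the generating function
(`ε = 1` for selections, `ε = -1` for multisets), with its leading part `K j^{r-1} z^j` removed. -/
noncomputable def logFactorRemainder (ε : ℝ) (a : ℕ → ℕ) (K r y : ℝ) (j : ℕ) (z : ℂ) : ℂ :=
  ε * a j * Complex.log (1 + ε * (z / y) ^ j) - K * ((j : ℝ) ^ (r - 1) : ℝ) * z ^ j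

theorem norm_div_pow_le {y : ℝ} (hy : 1 < y) {z : ℂ} (hz : ‖z‖ ≤ 1) (j : ℕ) :
    ‖(z / y) ^ j‖ ≤ y⁻¹ ^ j := by
  have hy0 : 0 < y := by linarith
  rw [norm_pow, norm_div, Complex.norm_real, Real.norm_of_nonneg hy0.le, ← one_div]
  gcongr

theorem norm_div_pow_lt_one {y : ℝ} (hy : 1 < y) {z : ℂ} (hz : ‖z‖ ≤ 1) {j : ℕ} (hj : 1 ≤ j) :
    ‖(z / y) ^ j‖ < 1 :=
  (norm_div_pow_le hy hz j).trans_lt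
    (pow_lt_one₀ (inv_nonneg.2 (by linarith)) (inv_lt_one_of_one_lt₀ hy) (by omega))

theorem one_add_mul_mem_slitPlane {ε : ℝ} (hε : |ε| = 1) {w : ℂ} (hw : ‖w‖ < 1) :
    1 + ε * w ∈ Complex.slitPlane := by
  refine Complex.mem_slitPlane_of_norm_lt_one ?_
  rwa [norm_mul, Complex.norm_real, Real.norm_eq_abs, hε, one_mul]

theorem continuousOn_logFactorRemainder {ε : ℝ} (hε : |ε| = 1) (a : ℕ → ℕ) (K r : ℝ) {y : ℝ}
    (hy : 1 < y) {j : ℕ} (hj : 1 ≤ j) :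
    ContinuousOn (logFactorRemainder ε a K r y j) (Metric.closedBall 0 1) := by
  unfold logFactorRemainder
  refine ContinuousOn.sub (ContinuousOn.mul continuousOn_const ?_) (by fun_prop)
  refine ContinuousOn.clog (by fun_prop) fun z hz => ?_
  exact one_add_mul_mem_slitPlane hε (norm_div_pow_lt_one hy (by simpa using hz) hj)

/-- Two errors occur. Linearising the logarithm costs O(a_j y^{-2j}), which is O((j^{r-1} + 1)
y^{-j}) and summable since y > 1. Replacing a_j y^{-j} by K j^{r-1} costs O(y^{(ν-1)j}), summable
since ν < 1. Neither bound depends on the sign ε. -/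
theorem exists_summable_norm_logFactorRemainder_le {a : ℕ → ℕ} {K r y ν : ℝ}
    (hy : 1 < y) (hν : ν < 1)
    (ha : (fun j : ℕ => (a j : ℝ) - K * (j : ℝ) ^ (r - 1) * y ^ j) =O[atTop]
      (fun j : ℕ => y ^ (ν * (j : ℝ)))) :
    ∃ u : ℕ → ℝ, Summable u ∧ ∀ ε : ℝ, |ε| = 1 → ∀ j, 1 ≤ j → ∀ z : ℂ, ‖z‖ ≤ 1 →
      ‖logFactorRemainder ε a K r y j z‖ ≤ u j := by
  have hy0 : 0 < y := by linarith
  have hyi : y⁻¹ < 1 := inv_lt_one_of_one_lt₀ hy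
  obtain ⟨C, hC0, hC⟩ := bound_of_isBigO_nat_atTop ha
  have hC' : ∀ j : ℕ, |(a j : ℝ) * y⁻¹ ^ j - K * (j : ℝ) ^ (r - 1)| ≤ C * (y ^ (ν - 1)) ^ j := by
    intro j
    have h1 := hC (x := j) (by positivity)
    rw [Real.norm_eq_abs, Real.norm_of_nonneg (by positivity)] at h1
    have h2 : (a j : ℝ) * y⁻¹ ^ j - K * (j : ℝ) ^ (r - 1) =
        (a j - K * (j : ℝ) ^ (r - 1) * y ^ j) * y⁻¹ ^ j := by
      rw [sub_mul, mul_assoc _ (y ^ j), ← mul_pow, mul_inv_cancel₀ hy0.ne', one_pow, mul_one]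
    have h3 : (y ^ (ν - 1)) ^ j = y ^ (ν * (j : ℝ)) * y⁻¹ ^ j := by
      rw [Real.rpow_sub_one hy0.ne', div_eq_mul_inv, mul_pow, Real.rpow_mul hy0.le,
        Real.rpow_natCast]
    rw [h2, h3, abs_mul, abs_of_nonneg (by positivity : 0 ≤ y⁻¹ ^ j), ← mul_assoc]
    gcongr
  have hq : y ^ (ν - 1) < 1 := Real.rpow_lt_one_of_one_lt_of_neg hy (by linarith)
  have hgeo1 : Summable fun j : ℕ => (y ^ (ν - 1)) ^ j :=
    summable_geometric_of_lt_one (by positivity) hq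
  have hgeo2 : Summable fun j : ℕ => y⁻¹ ^ j :=
    summable_geometric_of_lt_one (by positivity) hyi
  refine ⟨fun j => (K * powExp (r - 1) (Real.log y) j + C * y⁻¹ ^ j) * (1 - y⁻¹)⁻¹ +
    C * (y ^ (ν - 1)) ^ j, ?_, fun ε hε j hj z hz => ?_⟩
  · exact ((((summable_powExp (r - 1) (Real.log_pos hy)).mul_left K).add
      (hgeo2.mul_left C)).mul_right _).add (hgeo1.mul_left C)
  · set w : ℂ := (z / y) ^ j with hw
    have hwn : ‖w‖ ≤ y⁻¹ ^ j := norm_div_pow_le hy hz j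
    have hyj : y⁻¹ ^ j ≤ y⁻¹ := pow_le_of_le_one (by positivity) hyi.le (by omega)
    have hε2 : (ε : ℂ) * ε = 1 := by
      rw [← Complex.ofReal_mul, ← abs_mul_abs_self, hε]; simp
    have hεw : ‖(ε : ℂ) * w‖ = ‖w‖ := by
      rw [norm_mul, Complex.norm_real, Real.norm_eq_abs, hε, one_mul]
    -- As ε² = 1, the linear term of ε log(1 + εw) is w for both signs; hence the common leading
    -- part.
    have hsplit : logFactorRemainder ε a K r y j z =
        a j * (ε * (Complex.log (1 + ε * w) - ε * w)) +
          ((a j * y⁻¹ ^ j - K * (j : ℝ) ^ (r - 1) : ℝ) : ℂ) * z ^ j := by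
      have h1 : w = ((y⁻¹ ^ j : ℝ) : ℂ) * z ^ j := by
        rw [hw, div_eq_mul_inv, mul_pow]; push_cast; ring
      rw [logFactorRemainder, mul_sub (ε : ℂ), ← mul_assoc (ε : ℂ) (ε : ℂ) w, hε2, one_mul, mul_sub,
        ← hw]
      nth_rewrite 3 [h1]
      push_cast
      ring
    have hlog := Complex.norm_log_one_add_sub_self_le (z := ε * w)
      (by rw [hεw]; exact hwn.trans_lt (hyj.trans_lt hyi))
    rw [hεw] at hlog
    have h2 : ‖(a j : ℂ) * (ε * (Complex.log (1 + ε * w) - ε * w))‖ ≤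
        (K * powExp (r - 1) (Real.log y) j + C * y⁻¹ ^ j) * (1 - y⁻¹)⁻¹ := by
      rw [norm_mul, norm_mul, Complex.norm_real, Real.norm_eq_abs, hε, one_mul, Complex.norm_natCast]
      have h3 : ‖Complex.log (1 + ε * w) - ε * w‖ ≤ (y⁻¹ ^ j) ^ 2 * (1 - y⁻¹)⁻¹ := by
        refine hlog.trans ?_
        have h4 : (1 - ‖w‖)⁻¹ ≤ (1 - y⁻¹)⁻¹ :=
          inv_anti₀ (by linarith) (by linarith [hwn.trans hyj])
        have h5 : 0 ≤ (1 - y⁻¹)⁻¹ := inv_nonneg.2 (by linarith)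
        have h6 : 0 ≤ (1 - ‖w‖)⁻¹ := inv_nonneg.2 (by linarith)
        calc ‖w‖ ^ 2 * (1 - ‖w‖)⁻¹ / 2 ≤ (y⁻¹ ^ j) ^ 2 * (1 - y⁻¹)⁻¹ / 2 := by gcongr
          _ ≤ _ := half_le_self (by positivity)
      have h6 : (a j : ℝ) * (y⁻¹ ^ j) ^ 2 ≤ K * powExp (r - 1) (Real.log y) j + C * y⁻¹ ^ j := by
        have h7 : (a j : ℝ) * y⁻¹ ^ j ≤ K * (j : ℝ) ^ (r - 1) + C := by
          have h8 := (abs_le.1 (hC' j)).2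
          have h9 : C * (y ^ (ν - 1)) ^ j ≤ C * 1 := by
            gcongr; exact pow_le_one₀ (by positivity) hq.le
          linarith
        have h10 : y⁻¹ ^ j = Real.exp (-(j * Real.log y)) := by
          rw [← Real.exp_log (pow_pos (inv_pos.2 hy0) j), Real.log_pow, Real.log_inv]
          congr 1; ring
        rw [powExp_of_ne_zero _ _ (by omega), ← h10]
        have := mul_le_mul_of_nonneg_right h7 (by positivity : 0 ≤ y⁻¹ ^ j)
        linarith
      calc (a j : ℝ) * ‖Complex.log (1 + ε * w) - ε * w‖
          ≤ a j * ((y⁻¹ ^ j) ^ 2 * (1 - y⁻¹)⁻¹) := by gcongr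
        _ = a j * (y⁻¹ ^ j) ^ 2 * (1 - y⁻¹)⁻¹ := by ring
        _ ≤ _ := mul_le_mul_of_nonneg_right h6 (inv_nonneg.2 (by linarith))
    rw [hsplit]
    refine (norm_add_le _ _).trans (add_le_add h2 ?_)
    rw [norm_mul, Complex.norm_real, Real.norm_eq_abs, norm_pow]
    exact (mul_le_of_le_one_right (abs_nonneg _) (pow_le_one₀ (norm_nonneg _) hz)).trans (hC' j)

theorem logFactorRemainder_one {ε : ℝ} (hε : |ε| = 1) (a : ℕ → ℕ) (K r : ℝ) {y : ℝ} (hy : 1 < y)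
    {j : ℕ} (hj : 1 ≤ j) :
    logFactorRemainder ε a K r y j 1 =
      ((ε * a j * Real.log (1 + ε * y⁻¹ ^ j) - K * (j : ℝ) ^ (r - 1) : ℝ) : ℂ) := by
  have h1 : y⁻¹ ^ j < 1 :=
    pow_lt_one₀ (inv_nonneg.2 (by linarith)) (inv_lt_one_of_one_lt₀ hy) (by omega)
  have h0 : 0 ≤ y⁻¹ ^ j := pow_nonneg (inv_nonneg.2 (by linarith)) j
  have h2 : 0 ≤ 1 + ε * y⁻¹ ^ j := by
    have := (abs_le.1 hε.le).1
    nlinarith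
  rw [logFactorRemainder]
  push_cast [Complex.ofReal_log h2]
  rw [one_pow, mul_one, one_div]

/-- Otherwise K j^{r-1} y^j would be O(y^{νj}), which is impossible for ν < 1. This is what makes
the two constants differ strictly. -/
theorem exists_one_le_and_ne_zero {a : ℕ → ℕ} {K r y ν : ℝ} (hK : 0 < K) (hy : 1 < y) (hν : ν < 1)
    (ha : (fun j : ℕ => (a j : ℝ) - K * (j : ℝ) ^ (r - 1) * y ^ j) =O[atTop]
      (fun j : ℕ => y ^ (ν * (j : ℝ)))) : ∃ j, 1 ≤ j ∧ a j ≠ 0 := by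
  by_contra! hcon
  have hy0 : 0 < y := by linarith
  obtain ⟨C, hC0, hC⟩ := bound_of_isBigO_nat_atTop ha
  have hb : 0 < (1 - ν) * Real.log y := mul_pos (by linarith) (Real.log_pos hy)
  have h0 := ((tendsto_rpow_mul_exp_neg_mul_atTop_nhds_zero (1 - r) _ hb).comp
    tendsto_natCast_atTop_atTop).const_mul C
  rw [mul_zero] at h0
  obtain ⟨j, h1, h2⟩ := ((h0.eventually_lt_const hK).and (eventually_ge_atTop 1)).exists
  have hj0 : (0 : ℝ) < j := by exact_mod_cast h2
  have h3 := hC (x := j) (by positivity)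
  rw [hcon j h2, Nat.cast_zero, zero_sub, norm_neg, Real.norm_of_nonneg (by positivity),
    Real.norm_of_nonneg (by positivity)] at h3
  have h4 : y ^ (ν * (j : ℝ)) = Real.exp (-((1 - ν) * Real.log y) * j) * y ^ j := by
    rw [← Real.rpow_natCast, Real.rpow_def_of_pos hy0, Real.rpow_def_of_pos hy0, ← Real.exp_add]
    congr 1; ring
  rw [h4, ← mul_assoc] at h3
  have h5 : K * (j : ℝ) ^ (r - 1) ≤ C * Real.exp (-((1 - ν) * Real.log y) * j) :=
    le_of_mul_le_mul_right h3 (by positivity)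
  have h6 := mul_le_mul_of_nonneg_right h5 (by positivity : 0 ≤ (j : ℝ) ^ (1 - r))
  rw [mul_assoc, ← Real.rpow_add hj0, show r - 1 + (1 - r) = 0 by ring, Real.rpow_zero, mul_one]
    at h6
  simp only [Function.comp] at h1
  linarith

theorem exp_neg_add_mul_I_pow {y : ℝ} (hy : 0 < y) (δ θ : ℝ) (j : ℕ) :
    Complex.exp (-((Real.log y + δ : ℝ) : ℂ) + θ * Complex.I) ^ j =
      (Complex.exp (-δ + θ * Complex.I) / y) ^ j := by
  congr 1
  have h1 : (y : ℂ) = Complex.exp (Real.log y) := by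
    rw [← Complex.ofReal_exp, Real.exp_log hy]
  conv_rhs => rw [h1]
  rw [← Complex.exp_sub]
  congr 1; push_cast; ring

theorem mul_powExp_mul_exp_add_logFactorRemainder (ε : ℝ) (a : ℕ → ℕ) (K r y δ θ : ℝ) {j : ℕ}
    (hj : 1 ≤ j) :
    (K * powExp (r - 1) δ j : ℝ) * Complex.exp ((j * θ : ℝ) * Complex.I) +
      logFactorRemainder ε a K r y j (Complex.exp (-δ + θ * Complex.I)) =
    a j * (ε * Complex.log (1 + ε * (Complex.exp (-δ + θ * Complex.I) / y) ^ j)) := by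
  have h1 : Complex.exp (-δ + θ * Complex.I) ^ j =
      Real.exp (-(j * δ)) * Complex.exp ((j * θ : ℝ) * Complex.I) := by
    push_cast
    rw [← Complex.exp_nat_mul, ← Complex.exp_add]
    congr 1; ring
  rw [logFactorRemainder, h1, powExp_of_ne_zero _ _ (by omega)]
  push_cast
  ring

/-- The multiplicities a_j are integers, so exponentiating the principal logarithms recovers the
powers of the factors. -/
theorem exp_sum_logFactor {ε : ℝ} (a : ℕ → ℕ) (K r y δ θ : ℝ) (n : ℕ) :
    Complex.exp (∑ j ∈ Finset.Icc 1 n, (K * powExp (r - 1) δ j : ℝ) *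
        Complex.exp ((j * θ : ℝ) * Complex.I) +
      ∑ j ∈ Finset.Icc 1 n, logFactorRemainder ε a K r y j (Complex.exp (-δ + θ * Complex.I))) =
    ∏ j ∈ Finset.Icc 1 n, Complex.exp
      (ε * Complex.log (1 + ε * (Complex.exp (-δ + θ * Complex.I) / y) ^ j)) ^ a j := by
  rw [← Finset.sum_add_distrib, Complex.exp_sum]
  refine Finset.prod_congr rfl fun j hj => ?_
  rw [mul_powExp_mul_exp_add_logFactorRemainder _ _ _ _ _ _ _ (Finset.mem_Icc.1 hj).1,
    Complex.exp_nat_mul]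

theorem norm_exp_neg_add_mul_I_le_one {δ : ℝ} (hδ : 0 < δ) (θ : ℝ) :
    ‖Complex.exp (-δ + θ * Complex.I)‖ ≤ 1 := by
  rw [Complex.norm_exp]
  simpa using hδ.le

/-! ### Proof of the two assertions -/

theorem explicit_asymptotics {a : ℕ → ℕ} {K r y ν : ℝ} (hK : 0 < K) (hr : 0 < r) (hy : 1 < y)
    (hν : ν < 1)
    (ha : (fun j : ℕ => (a j : ℝ) - K * (j : ℝ) ^ (r - 1) * y ^ j) =O[atTop]
      (fun j : ℕ => y ^ (ν * (j : ℝ)))) :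
    ∃ κ₁ κ₁' : ℝ, 0 < κ₁ ∧ 0 < κ₁' ∧ κ₁' ≠ κ₁ ∧
      (fun n : ℕ => (multisetCount a n : ℝ)) ~[atTop] (fun n => κ₁ * explicitGrowth K r y n) ∧
      (fun n : ℕ => (selectionCount a n : ℝ)) ~[atTop]
        (fun n => κ₁' * explicitGrowth K r y n) := by
  have hy0 : 0 < y := by linarith
  obtain ⟨u, hu, hb⟩ := exists_summable_norm_logFactorRemainder_le hy hν ha
  obtain ⟨C₀, hC₀, hmain⟩ := exists_isEquivalent_explicitGrowth hK hr hy0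
  set t : ℝ → ℕ → ℝ := fun ε j => if j = 0 then 0 else
    ε * a j * Real.log (1 + ε * y⁻¹ ^ j) - K * (j : ℝ) ^ (r - 1) with ht
  have htc : ∀ ε : ℝ, |ε| = 1 → ∀ j,
      (if j = 0 then 0 else logFactorRemainder ε a K r y j 1) = ((t ε j : ℝ) : ℂ) := by
    intro ε hε j
    simp only [ht]
    split_ifs with hj
    · simp
    · exact logFactorRemainder_one hε a K r hy (Nat.one_le_iff_ne_zero.2 hj)
  have hts : ∀ ε : ℝ, |ε| = 1 → Summable (t ε) := by
    intro ε hε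
    refine Summable.of_norm_bounded hu.abs fun j => ?_
    rw [← Complex.norm_real, ← htc ε hε j]
    split_ifs with hj
    · simp
    · exact (hb ε hε j (Nat.one_le_iff_ne_zero.2 hj) 1 (by simp)).trans (le_abs_self _)
  have hH : ∀ ε : ℝ, |ε| = 1 → HasSum
      (fun j => if j = 0 then 0 else logFactorRemainder ε a K r y j 1) ((∑' j, t ε j : ℝ) : ℂ) := by
    intro ε hε
    simp only [htc ε hε]
    exact Complex.hasSum_ofReal.2 (hts ε hε).hasSum
  have h1 : |(1 : ℝ)| = 1 := abs_one
  have h2 : |(-1 : ℝ)| = 1 := by simp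
  refine ⟨C₀ * Real.exp (∑' j, t (-1) j), C₀ * Real.exp (∑' j, t 1 j), by positivity,
    by positivity, ?_, ?_, ?_⟩
  · have hlt : ∑' j, t 1 j < ∑' j, t (-1) j := by
      have hterm : ∀ j, 1 ≤ j → t (-1) j - t 1 j = -(a j * Real.log (1 - (y⁻¹ ^ j) ^ 2)) ∧
          Real.log (1 - (y⁻¹ ^ j) ^ 2) < 0 := by
        intro j hj
        have hx1 : y⁻¹ ^ j < 1 :=
          pow_lt_one₀ (inv_nonneg.2 hy0.le) (inv_lt_one_of_one_lt₀ hy) (by omega)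
        have hx0 : 0 < y⁻¹ ^ j := pow_pos (inv_pos.2 hy0) j
        constructor
        · simp only [ht, if_neg (by omega : j ≠ 0)]
          rw [show 1 - (y⁻¹ ^ j) ^ 2 = (1 + -1 * y⁻¹ ^ j) * (1 + 1 * y⁻¹ ^ j) by ring,
            Real.log_mul (by linarith) (by linarith)]
          ring
        · exact Real.log_neg (by nlinarith) (by nlinarith)
      obtain ⟨i, hi, hai⟩ := exists_one_le_and_ne_zero hK hy hν ha
      refine (hts 1 h1).tsum_lt_tsum (i := i) (fun j => ?_) ?_ (hts (-1) h2)
      · rcases Nat.eq_zero_or_pos j with rfl | hj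
        · simp [ht]
        · obtain ⟨h3, h4⟩ := hterm j hj
          have : (a j : ℝ) * Real.log (1 - (y⁻¹ ^ j) ^ 2) ≤ 0 :=
            mul_nonpos_of_nonneg_of_nonpos (a j).cast_nonneg h4.le
          linarith
      · obtain ⟨h3, h4⟩ := hterm i hi
        have : (a i : ℝ) * Real.log (1 - (y⁻¹ ^ i) ^ 2) < 0 :=
          mul_neg_of_pos_of_neg (by exact_mod_cast Nat.pos_of_ne_zero hai) h4
        linarith
    exact (mul_lt_mul_of_pos_left (Real.exp_lt_exp.2 hlt) hC₀).ne
  · refine hmain (logFactorRemainder (-1) a K r y) u _ _ hu (hb (-1) h2)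
      (fun j hj => continuousOn_logFactorRemainder h2 a K r hy hj) (hH (-1) h2) ?_
    filter_upwards [eventually_ge_atTop 1] with n hn
    have hδ := leadingSaddle_pos hK hr hn
    rw [Complex.ofReal_natCast, multisetCount_eq_integral a hn
      (add_pos (Real.log_pos hy) hδ)]
    congr 2
    funext θ
    rw [exp_sum_logFactor]
    congr 1
    refine Finset.prod_congr rfl fun j hj => ?_
    have hw := norm_div_pow_lt_one hy (norm_exp_neg_add_mul_I_le_one hδ θ) (Finset.mem_Icc.1 hj).1
    rw [exp_neg_add_mul_I_pow hy0]
    congr 1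
    have hs := Complex.slitPlane_ne_zero (one_add_mul_mem_slitPlane h2 hw)
    rw [Complex.ofReal_neg, Complex.ofReal_one, neg_one_mul] at hs
    rw [Complex.ofReal_neg, Complex.ofReal_one, neg_one_mul, neg_one_mul, Complex.exp_neg,
      Complex.exp_log hs, ← sub_eq_add_neg]
  · refine hmain (logFactorRemainder 1 a K r y) u _ _ hu (hb 1 h1)
      (fun j hj => continuousOn_logFactorRemainder h1 a K r hy hj) (hH 1 h1) ?_
    filter_upwards [eventually_ge_atTop 1] with n hn
    have hδ := leadingSaddle_pos hK hr hn
    rw [Complex.ofReal_natCast, selectionCount_eq_integral a hn (Real.log y + leadingSaddle K r n)]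
    congr 2
    funext θ
    rw [exp_sum_logFactor]
    congr 1
    refine Finset.prod_congr rfl fun j hj => ?_
    have hw := norm_div_pow_lt_one hy (norm_exp_neg_add_mul_I_le_one hδ θ) (Finset.mem_Icc.1 hj).1
    rw [exp_neg_add_mul_I_pow hy0]
    congr 1
    have hs := Complex.slitPlane_ne_zero (one_add_mul_mem_slitPlane h1 hw)
    rw [Complex.ofReal_one, one_mul] at hs
    rw [Complex.ofReal_one, one_mul, one_mul, Complex.exp_log hs]

theorem theorem4 (a : ℕ → ℕ) :
    (∀ r y : ℝ, 0 < r → 1 ≤ y → Expansive a r y →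
      (∀ᶠ n : ℕ in atTop, ∃ s : ℝ, 0 < s ∧ selectionMean a n s = n ∧
        ∀ t : ℝ, selectionMean a n t = n → t = s) ∧
      ∀ σ : ℕ → ℝ, (∀ᶠ n : ℕ in atTop, selectionMean a n (σ n) = n) →
        (fun n : ℕ => (selectionCount a n : ℝ)) ~[atTop]
          fun n : ℕ => Real.exp (n * σ n) / √(2 * Real.pi * selectionVariance a n (σ n)) *
            ∏ j ∈ Finset.Icc 1 n, (1 + Real.exp (-(j * σ n))) ^ a j) ∧
    (∀ K r y ν : ℝ, 0 < K → 0 < r → 1 < y → 0 < ν → ν < 1 →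
      (fun j : ℕ => (a j : ℝ) - K * (j : ℝ) ^ (r - 1) * y ^ j) =O[atTop]
        (fun j : ℕ => y ^ (ν * (j : ℝ))) →
      ∃ κ₁ κ₁' : ℝ, 0 < κ₁ ∧ 0 < κ₁' ∧ κ₁' ≠ κ₁ ∧
        (fun n : ℕ => (multisetCount a n : ℝ)) ~[atTop] (fun n => κ₁ * explicitGrowth K r y n) ∧
        (fun n : ℕ => (selectionCount a n : ℝ)) ~[atTop]
          (fun n => κ₁' * explicitGrowth K r y n)) := by
  refine ⟨fun r y hr hy ⟨D₁, D₂, hD₁, hD₂, hD⟩ => ?_,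
    fun K r y ν hK hr hy _ hν ha => explicit_asymptotics hK hr hy hν ha⟩
  -- A positive lower bound for an integer makes it at least 1.
  have ha : ∀ j, 1 ≤ j → 1 ≤ a j := by
    intro j hj
    have hj0 : (0 : ℝ) < j := by exact_mod_cast hj
    have : (0 : ℝ) < a j := lt_of_lt_of_le (by positivity) (hD j hj).1
    exact_mod_cast this
  refine ⟨?_, fun σ hσ => selectionCount_isEquivalent hr hy hD₁ hD₂ ha (fun j hj => (hD j hj).1)
    (fun j hj => (hD j hj).2) hσ⟩
  filter_upwards [eventually_ge_atTop 4] with n hn using exists_unique_selectionMean_eq ha hn
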